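/- **Setting.** For $d,m\ge 1$ and $n\ge 0$ let $\Sigma^{d,m,n}$ be the aggregator, which maps a vector of at most $n$ messages in $\{0,\dots,m-1\}^d$ to their coordinatewise sum modulo $m$. For probability measures put $\mathrm{LLR}(\mu,\nu)=\sup_E|\ln(\mu(E)/\nu(E))|$ over the events $E$ with $\mu(E)>0$ or $\nu(E)>0$ (with $a/0=\infty$ for $a>0$, $|\ln 0|=|\ln\infty|=\infty$), and $\mathrm{SD}(\mu,\nu)=\sup_E|\mu(E)-\nu(E)|$. A randomized algorithm $I$ on such vectors is an $(\hat\varepsilon,q)$-relaxation of $\Sigma^{d,m,n}$ if there is a simulator $\mathrm{SIM}$ with $\mathrm{LLR}(I(\vec y),\mathrm{SIM}(\Sigma^{d,m,n}(\vec y)))\le\hat\varepsilon$ for all $\vec y$, and a (possibly randomized) post-processing $\mathrm{POST}$ with $\mathrm{SD}(\mathrm{POST}(I(\vec y)),\Sigma^{d,m,n}(\vec y))\le q$ for all $\vec y$. **Protocol.** Let $I_n$ be a $(\hat\varepsilon,1/200)$-relaxation of $\Sigma^{d,m,n}$, $\hat\varepsilon\ge0$, with post-processing $\mathrm{POST}_n$.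 The preliminary tester $P$ for $n$ users with data $x_i\in[d]$ and parameters $\lambda\in(0,1)$, $m,\tau\in\mathbb N$, $m\ge1$, $\ell\in\mathbb R$, $N>0$ is as follows. * User $i$ sends $y_i\in\{0,\dots,m-1\}^d$ with $y_{i,j}=\mathbf 1[x_i=j]+\eta^+_{i,j}-\eta^-_{i,j}\bmod m$, where all $\eta^{\pm}_{i,j}$ are independent samples from the Pólya distribution $\mathrm{Polya}(2/n,\lambda)$, which has mass $\frac{\Gamma(r+k)}{\Gamma(r)\,k!}\lambda^k(1-\lambda)^r$ at $k\ge 0$, with $r=2/n$. * The analyzer computes $y=\mathrm{POST}_n(I_n(y_1,\dots,y_n))$. If $n>0$ it puts $\hat c_j=y_j-m$ if $y_j>n+2\tau$ and $\hat c_j=y_j$ otherwise. If $n=0$, the $\hat c_j$ are independent samples from $\mathrm{DLap}_\tau(\lambda)*\mathrm{DLap}_\tau(\lambda)$, where $\mathrm{DLap}_\tau(\lambda)$ has mass proportional to $\lambda^{|v|}$ on the integers $v\in[-\tau,\tau]$. It computes $$Z'=\frac dN\sum_{j\in[d]}\Big[\big(\hat c_j-\tfrac Nd\big)^2-\hat c_j\Big]$$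 and reports "uniform" if $Z'\le\ell$ and "not uniform" otherwise. **Theorem.** Let $\varepsilon\in(0,1)$ and $\lambda=e^{-\varepsilon}$. 1. For all $d,n,m,\tau,\ell,N$ as above and every such $I_n$, $\mathrm{POST}_n$, the protocol $P$ is $(4\hat\varepsilon+2\varepsilon)$-robustly differentially private: for every attack $T=(C,W)$, that is, a set $C\subseteq[n]$ of corrupted users with $|C|\le n/2$ who send arbitrary messages $W=(w_i)_{i\in C}$ in $\{0,\dots,m-1\}^d$ or drop out, and for all $\vec x,\vec x\,'\in[d]^n$ that differ in one index $i\notin C$, the adversary's views $(C,W,\vec x_C,I_n(\vec y))$ on $\vec x$ and on $\vec x\,'$ are at LLR distance at most $4\hat\varepsilon+2\varepsilon$. 2. There is an absolute constant $K>0$ such that for all $d\ge1$, $\varepsilon\in(0,1)$ and $\alpha>0$ there are choices of $\ell$ (as a function of $N$), $m$ (as a function of $n$) and $\tau$, not depending on $\hat\varepsilon$ or on the intermediaries, for which $P$ solves $\alpha$-uniformity testing with sample complexity $$N^*=K\left(\frac{d^{3/4}}{\alpha\varepsilon}+\frac{d^{2/3}}{\alpha^{4/3}\varepsilon^{2/3}}+\frac{\sqrt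 d}{\alpha^2}\right).$$ That is, for every $\hat\varepsilon\ge0$, all $(\hat\varepsilon,1/200)$-relaxations $I_n$ of $\Sigma^{d,m(n),n}$ with post-processings $\mathrm{POST}_n$ ($n\ge0$), every real $N\ge N^*$ and every distribution $\mathbf D$ on $[d]$, when $n\sim\mathrm{Pois}(N)$ users hold independent samples from $\mathbf D$, $P$ reports "not uniform" with probability at most $1/3$ if $\mathbf D$ is the uniform distribution $\mathbf U$ on $[d]$, and with probability at least $2/3$ if $\mathrm{SD}(\mathbf D,\mathbf U)>\alpha$. -/

import Mathlib

open MeasureTheory ProbabilityTheory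
open scoped NNReal ENNReal

universe u

noncomputable section

namespace SecureIntermediary

/-! ### Discrete distributions -/

theorem tsum_prod_eq_one {β : Type*} : ∀ (n : ℕ) (p : Fin n → PMF β),
    ∑' f : Fin n → β, ∏ i, p i (f i) = 1
  | 0, p => by simp
  | n + 1, p => by
    rw [← (Fin.consEquiv (fun _ : Fin (n + 1) => β)).tsum_eq, ENNReal.tsum_prod']
    simp only [Fin.consEquiv_apply, Fin.prod_univ_succ, Fin.cons_zero, Fin.cons_succ,
      ENNReal.tsum_mul_left]
    simp [tsum_prod_eq_one n, PMF.tsum_coe]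

/-- The joint law of `n` independent random variables with laws `p 0, …, p (n - 1)`. -/
def indep {β : Type*} {n : ℕ} (p : Fin n → PMF β) : PMF (Fin n → β) :=
  ⟨fun f => ∏ i, p i (f i), by
    rw [← tsum_prod_eq_one n p]
    exact ENNReal.summable.hasSum⟩

/-- The Bernoulli distribution with bias `p ∈ [0, 1]`, as a distribution on `{0, 1} ⊆ ℤ`. -/
def bern (p : ℝ) (h0 : 0 ≤ p) (h1 : p ≤ 1) : PMF ℤ :=
  PMF.map (fun b : Bool => if b then 1 else 0)
    (PMF.ofFintype (fun b : Bool => if b then ENNReal.ofReal p else ENNReal.ofReal (1 - p)) (by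
      rw [Fintype.sum_bool, if_pos rfl, if_neg (by decide),
        ← ENNReal.ofReal_add h0 (by linarith)]
      simp))

theorem prod_eq_choose (r : ℝ) (k : ℕ) :
    ∏ i ∈ Finset.range k, (r + i) / (i + 1) = Ring.choose (r + k - 1) k := by
  have h1 := Ring.factorial_nsmul_multichoose_eq_ascPochhammer r k
  rw [Polynomial.ascPochhammer_smeval_eq_eval] at h1
  rw [← Ring.multichoose_eq]
  have h2 : ∀ k : ℕ, (∏ i ∈ Finset.range k, (r + i) / (i + 1)) * (k.factorial : ℝ)
      = (ascPochhammer ℝ k).eval r := by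
    intro k
    induction k with
    | zero => simp
    | succ k ih =>
      rw [Finset.prod_range_succ, ascPochhammer_succ_eval, ← ih, Nat.factorial_succ]
      push_cast
      field_simp
  have h3 := h2 k
  rw [← h1, nsmul_eq_mul, mul_comm] at h3
  exact mul_left_cancel₀ (by positivity) h3

theorem polya_hasSum (r : ℝ≥0) (lam : Set.Ioo (0 : ℝ) 1) :
    HasSum (fun k : ℕ => ENNReal.ofReal ((∏ i ∈ Finset.range k, ((r : ℝ) + i) / (i + 1)) *
      (lam : ℝ) ^ k * (1 - (lam : ℝ)) ^ (r : ℝ))) 1 := by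
  obtain ⟨l, hl0, hl1⟩ := lam
  have h := (Real.one_div_one_sub_rpow_hasFPowerSeriesOnBall_zero (r : ℝ)).hasSum (y := l)
    (by simp [enorm_eq_nnnorm, ← NNReal.coe_lt_one, abs_of_pos hl0, hl1])
  have hp : 0 < (1 - l) ^ (r : ℝ) := Real.rpow_pos_of_pos (by linarith) _
  have h' := h.mul_right ((1 - l) ^ (r : ℝ))
  simp only [FormalMultilinearSeries.ofScalars_apply_eq, zero_add, ← prod_eq_choose,
    smul_eq_mul] at h'
  rw [one_div, inv_mul_cancel₀ hp.ne'] at h'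
  have hnn : ∀ k : ℕ, 0 ≤ (∏ i ∈ Finset.range k, ((r : ℝ) + i) / (i + 1)) *
      l ^ k * (1 - l) ^ (r : ℝ) := fun k =>
    mul_nonneg (mul_nonneg (Finset.prod_nonneg fun i _ => by positivity) (by positivity)) hp.le
  have := ENNReal.ofReal_tsum_of_nonneg hnn h'.summable
  rw [h'.tsum_eq, ENNReal.ofReal_one] at this
  rw [this]
  exact ENNReal.summable.hasSum

/-- The Pólya (negative binomial) distribution with shape `r` and parameter `lam ∈ (0, 1)`: its mass
at `k` is `Γ(r + k) / (Γ(r) k!) * lam ^ k * (1 - lam) ^ r`, where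
`Γ(r + k) / (Γ(r) k!) = ∏_{i < k} (r + i) / (i + 1)`. -/
def polya (r : ℝ≥0) (lam : Set.Ioo (0 : ℝ) 1) : PMF ℕ :=
  ⟨fun k => ENNReal.ofReal ((∏ i ∈ Finset.range k, ((r : ℝ) + i) / (i + 1)) *
    (lam : ℝ) ^ k * (1 - (lam : ℝ)) ^ (r : ℝ)), polya_hasSum r lam⟩

/-- The unnormalized mass `lam ^ |v|` on `[-τ, τ]`. -/
def dlapWeight (τ : ℕ) (lam : Set.Ioo (0 : ℝ) 1) (v : ℤ) : ℝ≥0∞ :=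
  if v.natAbs ≤ τ then ENNReal.ofReal ((lam : ℝ) ^ v.natAbs) else 0

theorem tsum_dlapWeight_ne_zero (τ : ℕ) (lam : Set.Ioo (0 : ℝ) 1) :
    ∑' v, dlapWeight τ lam v ≠ 0 := by
  intro h
  have := ENNReal.tsum_eq_zero.1 h 0
  simp [dlapWeight] at this

theorem tsum_dlapWeight_ne_top (τ : ℕ) (lam : Set.Ioo (0 : ℝ) 1) :
    ∑' v, dlapWeight τ lam v ≠ ∞ := by
  rw [tsum_eq_sum (s := Finset.Icc (-(τ : ℤ)) τ)]
  · refine ENNReal.sum_ne_top.2 fun v _ => ?_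
    unfold dlapWeight
    split_ifs <;> simp
  · intro v hv
    rw [dlapWeight, if_neg]
    intro h
    exact hv (Finset.mem_Icc.2 (by omega))

/-- The truncated discrete Laplace distribution: mass proportional to `lam ^ |v|` on `[-τ, τ]`. -/
def dlapTrunc (τ : ℕ) (lam : Set.Ioo (0 : ℝ) 1) : PMF ℤ :=
  PMF.normalize (dlapWeight τ lam) (tsum_dlapWeight_ne_zero τ lam) (tsum_dlapWeight_ne_top τ lam)

/-! ### Distances between distributions -/

/-- Statistical (total variation) distance of two probability measures. -/
def statDist {Ω : Type*} [MeasurableSpace Ω] (μ ν : Measure Ω) : ℝ :=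
  ⨆ E : {E : Set Ω // MeasurableSet E}, |μ.real E - ν.real E|

/-- Log-likelihood-ratio distance: the supremum of `|ln (μ E / ν E)|` over the events `E` to which
at least one of the two measures gives positive mass. Here `a / 0 = ∞` for `a ≠ 0`,
`ln 0 = -∞`, `ln ∞ = ∞`. -/
def llrDist {Ω : Type*} [MeasurableSpace Ω] (μ ν : Measure Ω) : ℝ≥0∞ :=
  ⨆ (E : Set Ω) (_ : MeasurableSet E) (_ : μ E ≠ 0 ∨ ν E ≠ 0), (ENNReal.log (μ E / ν E)).abs

/-! ### Protocols with a secure intermediary -/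

/-- A protocol for `n` users with data in `X`, messages in `Y`, intermediary output in `O`, and
analyzer output in `Z`. The intermediary is a randomized algorithm on vectors of messages. -/
structure Protocol (n : ℕ) (X Y O Z : Type*) [MeasurableSpace O] [MeasurableSpace Z] where
  randomizer : Fin n → X → PMF Y
  intermediary : List Y → ProbabilityMeasure O
  analyzer : Kernel O Z
  markov : IsMarkovKernel analyzer

/-- An attack: a set of corrupted users, and for each of them the message it sends (`none` if the
user drops out). -/
structure Attack (n : ℕ) (Y : Type*) where
  corrupted : Finset (Fin n)
  message : {i // i ∈ corrupted} → Option Y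

/-- The part `(C, W, x_C)` of the adversary's view. -/
def Known (n : ℕ) (X Y : Type*) : Type _ :=
  Σ T : Attack n Y, ({i // i ∈ T.corrupted} → X)

instance (n : ℕ) (X Y : Type*) : MeasurableSpace (Known n X Y) := ⊤

/-- The law of the output of a randomized algorithm `κ` on a random input with law `p`. -/
def mix {A B : Type*} [MeasurableSpace B] (p : PMF A) (κ : A → ProbabilityMeasure B) : Measure B :=
  Measure.sum fun a => p a • (κ a : Measure B)

section

variable {n : ℕ} {X Y O Z : Type*} [MeasurableSpace O] [MeasurableSpace Z]

/-- The vector of messages received by the intermediary, absent an attack. -/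
def Protocol.messages (P : Protocol n X Y O Z) (x : Fin n → X) : PMF (List Y) :=
  (indep fun i => P.randomizer i (x i)).map List.ofFn

/-- The law of the output `P(x)` of the protocol, absent an attack. -/
def Protocol.output (P : Protocol n X Y O Z) (x : Fin n → X) : Measure Z :=
  (mix (P.messages x) P.intermediary).bind P.analyzer

/-- The vector of messages received by the intermediary under an attack; the messages of users
who drop out are missing from it. -/
def Protocol.attackedMessages (P : Protocol n X Y O Z) (T : Attack n Y) (x : Fin n → X) :
    PMF (List Y) :=
  (indep fun i => if h : i ∈ T.corrupted then PMF.pure (T.message ⟨i, h⟩)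
    else (P.randomizer i (x i)).map some).map fun y => (List.ofFn y).reduceOption

/-- The law of the adversary's view `(C, W, x_C, I(y))`. -/
def Protocol.view (P : Protocol n X Y O Z) (T : Attack n Y) (x : Fin n → X) :
    Measure (Known n X Y × O) :=
  (mix (P.attackedMessages T x) P.intermediary).map fun o => (⟨T, fun i => x i⟩, o)

/-- `ε`-robust differential privacy: at most half of the users are corrupted, and the two inputs
differ (at most) in the datum of one honest user. -/
def Protocol.RobustlyDP (P : Protocol n X Y O Z) (ε : ℝ) : Prop :=
  ∀ T : Attack n Y, 2 * T.corrupted.card ≤ n →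
    ∀ (x x' : Fin n → X) (i : Fin n), i ∉ T.corrupted → (∀ j, j ≠ i → x j = x' j) →
      llrDist (P.view T x) (P.view T x') ≤ ENNReal.ofReal ε

end

/-! ### Relaxed intermediaries -/

/-- `I` is `ε`-LLR secure with respect to `f` on vectors of at most `n` messages. -/
def LLRSecure {Y O S : Type*} [MeasurableSpace O] (ε : ℝ) (n : ℕ) (f : List Y → S)
    (I : List Y → ProbabilityMeasure O) : Prop :=
  ∃ sim : S → ProbabilityMeasure O, ∀ y : List Y, y.length ≤ n →
    llrDist (I y : Measure O) (sim (f y) : Measure O) ≤ ENNReal.ofReal ε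

/-- `I` is `q`-correct with respect to `f` on vectors of at most `n` messages, through the
(possibly randomized) post-processing `post`. -/
def CorrectVia {Y O S : Type*} [MeasurableSpace O] [MeasurableSpace S] (q : ℝ) (n : ℕ)
    (f : List Y → S) (I : List Y → ProbabilityMeasure O) (post : Kernel O S) : Prop :=
  ∀ y : List Y, y.length ≤ n →
    statDist ((I y : Measure O).bind post) (Measure.dirac (f y)) ≤ q

/-- `I` is an `(ε, q)`-relaxation of `f`, with `post` a post-processing that shows correctness. -/
def IsRelaxation {Y O S : Type*} [MeasurableSpace O] [MeasurableSpace S] (ε q : ℝ) (n : ℕ)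
    (f : List Y → S) (I : List Y → ProbabilityMeasure O) (post : Kernel O S) : Prop :=
  LLRSecure ε n f I ∧ CorrectVia q n f I post

/-- Vectors of dimension `d` with entries in `{0, …, m - 1}`. -/
abbrev Msg (d m : ℕ) : Type := Fin d → ZMod m

instance (d m : ℕ) : Countable (Msg d m) := by
  have : Countable (ZMod m) := by
    cases m
    · exact inferInstanceAs (Countable ℤ)
    · infer_instance
  infer_instance

/-- The aggregator: coordinatewise sum modulo `m`. -/
def aggregator (d m : ℕ) (y : List (Msg d m)) : Msg d m := y.sum

/-! ### The summation subroutine -/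

/-- The local randomizer for sums of `[0, 1]` values, for `n` users: randomized rounding of `x * g`
to an integer, plus the difference of two independent Pólya variables, modulo `m`. -/
def sumRandomizer (n m g : ℕ) (lam : Set.Ioo (0 : ℝ) 1) (x : ℝ) : PMF (ZMod m) :=
  (bern (Int.fract (x * g)) (Int.fract_nonneg _) (Int.fract_lt_one _).le).bind fun b =>
    (polya (2 / n) lam).bind fun ηp : ℕ =>
      (polya (2 / n) lam).map fun ηm : ℕ => ((⌊x * g⌋ + b + (ηp : ℤ) - (ηm : ℤ) : ℤ) : ZMod m)

/-- The analyzer for sums of `[0, 1]` values; `y.val ∈ {0, …, m - 1}`. -/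
def sumAnalyzer (n m g τ : ℕ) (y : ZMod m) : ℝ :=
  if y.val > n * g + 2 * τ then ((y.val : ℝ) - m) / g else (y.val : ℝ) / g

/-! ### The uniformity tester -/

inductive Verdict : Type
  | uniform : Verdict
  | notUniform : Verdict

instance : MeasurableSpace Verdict := ⊤

/-- The local randomizer: the summation randomizer with `g = 1`, run on every indicator `1[x = j]`
with independent randomness. -/
def utRandomizer (d n m : ℕ) (lam : Set.Ioo (0 : ℝ) 1) (x : Fin d) : PMF (Msg d m) :=
  indep fun j => sumRandomizer n m 1 lam (if x = j then 1 else 0)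

/-- The noisy histogram: the estimates of the summation analyzer if `n > 0`, and independent
samples from the convolution of two truncated discrete Laplace distributions if `n = 0`. -/
def noisyCounts (d n m τ : ℕ) (lam : Set.Ioo (0 : ℝ) 1) (y : Msg d m) : PMF (Fin d → ℝ) :=
  if 0 < n then PMF.pure fun j => sumAnalyzer n m 1 τ (y j)
  else indep fun _ => (dlapTrunc τ lam).bind fun a => (dlapTrunc τ lam).map fun b => ((a + b : ℤ) : ℝ)

/-- The debiased chi-squared statistic of a histogram `c`. -/
def chiSq (d : ℕ) (N : ℝ) (c : Fin d → ℝ) : ℝ :=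
  d / N * ∑ j, ((c j - N / d) ^ 2 - c j)

open Classical in
/-- The analyzer, run on a vector of (claimed) sums modulo `m`. -/
def utAnalyzer (d n m τ : ℕ) (lam : Set.Ioo (0 : ℝ) 1) (N ℓ : ℝ) (y : Msg d m) : PMF Verdict :=
  (noisyCounts d n m τ lam y).map fun c =>
    if chiSq d N c ≤ ℓ then Verdict.uniform else Verdict.notUniform

instance (d n m τ : ℕ) (lam : Set.Ioo (0 : ℝ) 1) (N ℓ : ℝ) :
    IsMarkovKernel (Kernel.ofFunOfCountable fun y : Msg d m =>
      (utAnalyzer d n m τ lam N ℓ y).toMeasure) :=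
  ⟨fun y => inferInstanceAs (IsProbabilityMeasure (utAnalyzer d n m τ lam N ℓ y).toMeasure)⟩

/-- The preliminary uniformity tester for `n` users over the universe `Fin d`, with intermediary
`I`: the analyzer post-processes the output of `I` by `post` into a vector of sums modulo `m`, and
then runs `utAnalyzer` on it. -/
def utProtocol (d n m τ : ℕ) (lam : Set.Ioo (0 : ℝ) 1) (N ℓ : ℝ) {O : Type*} [MeasurableSpace O]
    (I : List (Msg d m) → ProbabilityMeasure O) (post : Kernel O (Msg d m)) [IsMarkovKernel post] :
    Protocol n (Fin d) (Msg d m) O Verdict where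
  randomizer := fun _ => utRandomizer d n m lam
  intermediary := I
  analyzer := (Kernel.ofFunOfCountable fun y : Msg d m =>
    (utAnalyzer d n m τ lam N ℓ y).toMeasure) ∘ₖ post
  markov := inferInstance

/-- The probability that the protocol reports "not uniform" when `n ∼ Pois(N)` users hold
independent samples from `D`; here `P n` is the protocol for `n` users. -/
def probNotUniform {d : ℕ} {Y O : ℕ → Type*} [∀ n, MeasurableSpace (O n)]
    (P : (n : ℕ) → Protocol n (Fin d) (Y n) (O n) Verdict) (N : ℝ≥0) (D : PMF (Fin d)) : ℝ≥0∞ :=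
  ∫⁻ n, ∑' x : Fin n → Fin d, indep (fun _ => D) x * (P n).output x {Verdict.notUniform}
    ∂(poissonMeasure N)

/-- `α`-uniformity testing with sample complexity `Nstar`. Here `P N n` is the protocol for
`n` users when the expected number of users is `N`. -/
def SolvesUniformityTesting {d : ℕ} [NeZero d] {Y O : ℕ → Type*} [∀ n, MeasurableSpace (O n)]
    (P : ℝ≥0 → (n : ℕ) → Protocol n (Fin d) (Y n) (O n) Verdict) (α Nstar : ℝ) : Prop :=
  ∀ N : ℝ≥0, Nstar ≤ N →
    probNotUniform (P N) N (PMF.uniformOfFintype (Fin d)) ≤ 1 / 3 ∧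
    ∀ D : PMF (Fin d),
      α < statDist D.toMeasure (PMF.uniformOfFintype (Fin d)).toMeasure →
        2 / 3 ≤ probNotUniform (P N) N D

end SecureIntermediary

end

open SecureIntermediary MeasureTheory ProbabilityTheory

/-! Privacy. The sum of the messages is a convolution: a fixed contribution of the corrupted users,
the one-hot vectors of the honest users, and one share of noise per honest user. Pólya laws form a
convolution semigroup in the shape parameter, so at least `n / 2` honest shares of shape `2 / n` add
up to shape at least 1. For such a shape consecutive masses of the Pólya law decrease by a factor of
at least `λ`, so shifting it by one costs a likelihood factor of at most `1 / λ = e^ε`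
(`polya_dominated`). Changing one datum lowers one coordinate and raises another, which costs
`e^(2ε)` (`noise_dominated`). A relaxed intermediary is within `e^εhat` of a simulator that sees
only the sum. Passing from `I` to the simulator, comparing the sums, and passing back
(`mix_le_mix_of_dominated`) gives `2 * εhat + 2 * ε`, which is stronger than the claim.

Accuracy. Without an attack and for `n > 0`, the `n` shares add up to shape exactly 2, whatever `n`
is. Unless the noise overflows or the post-processing errs, the analyzer therefore sees the
histogram plus noise of a law independent of `n`. Since `n` is Poisson, the counts are independent
Poisson variables with means `N * D j` (`poissonLaw_bind_pow`), and the statistic becomes a sum of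
independent terms. With `b = N / d` and `r = N * D j`, such a term has mean `(r - b)^2` plus the
noise variance (`chiTerm_moments`). Hence the mean of the sum exceeds its value at the uniform
distribution by `S = ∑ j, (N * D j - N / d)^2`, and Cauchy–Schwarz gives `S ≥ s = α^2 * N^2 / d` for
`α`-far `D`.

The threshold lies `s / 2` above the uniform mean, and Chebyshev's inequality separates the two
cases once the variance is small against `s^2`, respectively `S^2`. The three summands of the sample
complexity control three variance contributions: `√d / α^2` the Poisson fluctuations `N^2 / d`, the
middle one the cross term `N / ε^2` of counts and noise, and `d^(3/4) / (α * ε)` the fourth moment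
`d / ε^4` of the noise (`variance_le_sq_div`). The remaining errors (`n = 0`, overflow,
post-processing) are small constants (`probVerdict_le`, `total_error_le`).

All laws of sums are computed in the commutative monoid of distributions under convolution, where
regrouping independent contributions is regrouping factors of a product. -/

noncomputable section

namespace SecureIntermediary

/-! ### Convolution of discrete distributions -/

section Convolution

variable {M N : Type*} [AddCommMonoid M] [AddCommMonoid N]

/-- Convolution makes the distributions on a commutative monoid a commutative monoid. -/
instance instCommMonoidPMF : CommMonoid (PMF M) where
  mul p q := p.bind fun a => q.map (a + ·)
  one := PMF.pure 0
  mul_assoc p q r := by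
    change (p.bind fun a => q.map (a + ·)).bind (fun a => r.map (a + ·)) =
      p.bind fun a => (q.bind fun b => r.map (b + ·)).map (a + ·)
    simp only [PMF.bind_bind, PMF.bind_map, PMF.map_bind, PMF.map_comp, Function.comp_def,
      add_assoc]
  one_mul p := by
    change (PMF.pure 0).bind (fun a => p.map (a + ·)) = p
    simp only [PMF.pure_bind, zero_add]
    exact PMF.map_id p
  mul_one p := by
    change p.bind (fun a => (PMF.pure 0).map (a + ·)) = p
    simp [PMF.pure_map]
  mul_comm p q := by
    change p.bind (fun a => q.map (a + ·)) = q.bind (fun a => p.map (a + ·))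
    simp only [← PMF.bind_pure_comp, Function.comp_def]
    rw [PMF.bind_comm]
    simp only [add_comm]

theorem pmf_mul_def (p q : PMF M) : p * q = p.bind fun a => q.map (a + ·) := rfl

theorem pmf_one_def : (1 : PMF M) = PMF.pure 0 := rfl

theorem pure_mul_pure (a b : M) : PMF.pure a * PMF.pure b = PMF.pure (a + b) := by
  simp [pmf_mul_def, PMF.pure_map]

theorem pure_mul_eq_map (a : M) (p : PMF M) : PMF.pure a * p = p.map (a + ·) := by
  simp [pmf_mul_def]

/-- Pushforward along an additive homomorphism is multiplicative for convolution. -/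
def mapHom (f : M →+ N) : PMF M →* PMF N where
  toFun p := p.map f
  map_one' := by simp [pmf_one_def, PMF.pure_map]
  map_mul' p q := by
    simp [pmf_mul_def, PMF.map_bind, PMF.bind_map, PMF.map_comp, Function.comp_def]

theorem mapHom_apply (f : M →+ N) (p : PMF M) : mapHom f p = p.map f := rfl

theorem mapHom_pure (f : M →+ N) (a : M) : mapHom f (PMF.pure a) = PMF.pure (f a) :=
  PMF.pure_map _ _

theorem mapHom_mapHom {L : Type*} [AddCommMonoid L] (g : N →+ L) (f : M →+ N) (p : PMF M) :
    mapHom g (mapHom f p) = mapHom (g.comp f) p := by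
  simp [mapHom_apply, PMF.map_comp]

end Convolution

/-! ### Independent families -/

section Indep

variable {β γ : Type*}

theorem indep_apply {n : ℕ} (p : Fin n → PMF β) (f : Fin n → β) :
    indep p f = ∏ i, p i (f i) := rfl

theorem tsum_pi_prod : ∀ (n : ℕ) (F : Fin n → β → ℝ≥0∞),
    ∑' f : Fin n → β, ∏ i, F i (f i) = ∏ i, ∑' b, F i b
  | 0, F => by simp
  | n + 1, F => by
    rw [← (Fin.consEquiv (fun _ : Fin (n + 1) => β)).tsum_eq, ENNReal.tsum_prod']
    simp only [Fin.consEquiv_apply, Fin.prod_univ_succ, Fin.cons_zero, Fin.cons_succ,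
      ENNReal.tsum_mul_left, ENNReal.tsum_mul_right]
    rw [tsum_pi_prod n]

/-- This is the distributive law for a product of sums; the analogous facts on `map` and convolution
follow from it. -/
theorem indep_bind {n : ℕ} (p : Fin n → PMF β) (q : Fin n → β → PMF γ) :
    (indep fun i => (p i).bind (q i)) = (indep p).bind fun a => indep fun i => q i (a i) := by
  ext f
  simp only [indep_apply, PMF.bind_apply]
  rw [← tsum_pi_prod n (fun i a => p i a * q i a (f i))]
  simp only [Finset.prod_mul_distrib]

theorem indep_pure {n : ℕ} (a : Fin n → β) : (indep fun i => PMF.pure (a i)) = PMF.pure a := by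
  ext f
  rw [indep_apply, PMF.pure_apply]
  split_ifs with h
  · simp [h]
  · obtain ⟨i, hi⟩ := Function.ne_iff.1 h
    exact Finset.prod_eq_zero (Finset.mem_univ i) (PMF.pure_apply_of_ne _ _ hi)

theorem indep_map {n : ℕ} (p : Fin n → PMF β) (f : Fin n → β → γ) :
    (indep fun i => (p i).map (f i)) = (indep p).map fun y i => f i (y i) := by
  simp only [← PMF.bind_pure_comp, indep_bind, Function.comp_def, indep_pure]

theorem indep_mul {M : Type*} [AddCommMonoid M] {n : ℕ} (p q : Fin n → PMF M) :
    (indep fun i => p i * q i) = indep p * indep q := by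
  simp only [pmf_mul_def, indep_bind, indep_map]
  rfl

/-- `indep` is multiplicative for convolution. -/
def indepHom (n : ℕ) (M : Type*) [AddCommMonoid M] : (Fin n → PMF M) →* PMF (Fin n → M) where
  toFun := indep
  map_one' := indep_pure 0
  map_mul' := indep_mul

theorem indep_succ {n : ℕ} (p : Fin (n + 1) → PMF β) :
    indep p = (p 0).bind fun a => (indep fun i : Fin n => p i.succ).map (Fin.cons a) := by
  classical
  ext f
  obtain ⟨⟨a, g⟩, rfl⟩ := (Fin.consEquiv (fun _ : Fin (n + 1) => β)).surjective f
  change indep p (Fin.cons (α := fun _ => β) a g) =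
    PMF.bind _ _ (Fin.cons (α := fun _ => β) a g)
  simp only [indep_apply, Fin.prod_univ_succ, Fin.cons_zero, Fin.cons_succ,
    PMF.bind_apply, PMF.map_apply, Fin.cons_inj]
  rw [tsum_eq_single a, tsum_eq_single g]
  · simp
  · intro b hb
    simp [hb.symm]
  · intro b hb
    simp [hb.symm]

theorem indep_map_sum {M : Type*} [AddCommMonoid M] : ∀ {n : ℕ} (p : Fin n → PMF M),
    (indep p).map (fun y => ∑ i, y i) = ∏ i, p i
  | 0, p => by
    simp only [Finset.univ_eq_empty, Finset.sum_empty, Finset.prod_empty, pmf_one_def]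
    exact PMF.map_const _ _
  | n + 1, p => by
    rw [Fin.prod_univ_succ, ← indep_map_sum, indep_succ]
    simp only [pmf_mul_def, PMF.map_bind, PMF.map_comp, Function.comp_def, Fin.sum_univ_succ,
      Fin.cons_zero, Fin.cons_succ]

theorem indep_map_sum_comp {M : Type*} [AddCommMonoid M] {n : ℕ} (p : Fin n → PMF β)
    (f : Fin n → β → M) :
    (indep p).map (fun y => ∑ i, f i (y i)) = ∏ i, (p i).map (f i) := by
  rw [← indep_map_sum, indep_map, PMF.map_comp]
  rfl

end Indep

/-! ### Pólya noise -/

section Polya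

theorem pmf_nat_mul_apply (p q : PMF ℕ) (k : ℕ) :
    (p * q) k = ∑ ij ∈ Finset.HasAntidiagonal.antidiagonal k, p ij.1 * q ij.2 := by
  simp only [pmf_mul_def, PMF.bind_apply, PMF.map_apply, ← ENNReal.tsum_mul_left, mul_ite, mul_zero]
  rw [← ENNReal.tsum_prod (f := fun a b => if k = a + b then p a * q b else 0),
    tsum_eq_sum (s := Finset.HasAntidiagonal.antidiagonal k)]
  · refine Finset.sum_congr rfl fun ij hij => ?_
    rw [if_pos (Finset.HasAntidiagonal.mem_antidiagonal.1 hij).symm]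
  · intro ij hij
    rw [if_neg]
    intro h
    exact hij (Finset.HasAntidiagonal.mem_antidiagonal.2 h.symm)

/-- Up to the sign `(-1) ^ k`, the product is the generalized binomial coefficient of `-r`, so this
is the Chu–Vandermonde identity for `-r` and `-s`. -/
theorem prod_add_eq_sum_antidiagonal (r s : ℝ) (k : ℕ) :
    ∏ i ∈ Finset.range k, ((r + s) + i) / (i + 1) = ∑ ij ∈ Finset.HasAntidiagonal.antidiagonal k,
      (∏ i ∈ Finset.range ij.1, (r + i) / (i + 1)) *
        ∏ i ∈ Finset.range ij.2, (s + i) / (i + 1) := by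
  have h : ∀ (r : ℝ) (k : ℕ), ∏ i ∈ Finset.range k, (r + i) / (i + 1) =
      (-1) ^ k * Ring.choose (-r) k := by
    intro r k
    rw [prod_eq_choose, Ring.choose_neg, Units.smul_def, zsmul_eq_mul, ← mul_assoc]
    have : ((-1 : ℝ)) ^ k * ((Int.negOnePow k : ℤˣ) : ℤ) = 1 := by
      rw [Int.negOnePow_def]
      simp [← mul_pow]
    rw [this, one_mul]
  simp only [h]
  rw [neg_add, Ring.add_choose_eq k (Commute.all _ _), Finset.mul_sum]
  refine Finset.sum_congr rfl fun ij hij => ?_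
  rw [← Finset.HasAntidiagonal.mem_antidiagonal.1 hij, pow_add]
  ring

variable {lam : Set.Ioo (0 : ℝ) 1}

theorem polya_apply (r : ℝ≥0) (k : ℕ) :
    polya r lam k = ENNReal.ofReal ((∏ i ∈ Finset.range k, ((r : ℝ) + i) / (i + 1)) *
      (lam : ℝ) ^ k * (1 - (lam : ℝ)) ^ (r : ℝ)) := rfl

theorem polya_mass_nonneg (r : ℝ≥0) (k : ℕ) :
    0 ≤ (∏ i ∈ Finset.range k, ((r : ℝ) + i) / (i + 1)) *
      (lam : ℝ) ^ k * (1 - (lam : ℝ)) ^ (r : ℝ) :=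
  mul_nonneg (mul_nonneg (Finset.prod_nonneg fun i _ => by positivity)
    (pow_nonneg lam.2.1.le _)) (Real.rpow_nonneg (by linarith [lam.2.2]) _)

/-- The Pólya distributions form a convolution semigroup in the shape parameter. -/
theorem polya_mul_polya (r s : ℝ≥0) : polya r lam * polya s lam = polya (r + s) lam := by
  ext k
  rw [pmf_nat_mul_apply]
  simp only [polya_apply]
  simp only [← ENNReal.ofReal_mul (polya_mass_nonneg _ _)]
  rw [← ENNReal.ofReal_sum_of_nonneg fun ij _ =>
    mul_nonneg (polya_mass_nonneg _ _) (polya_mass_nonneg _ _)]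
  congr 1
  rw [NNReal.coe_add, prod_add_eq_sum_antidiagonal, Real.rpow_add (by linarith [lam.2.2]),
    Finset.sum_mul, Finset.sum_mul]
  refine Finset.sum_congr rfl fun ij hij => ?_
  rw [← Finset.HasAntidiagonal.mem_antidiagonal.1 hij, pow_add]
  ring

theorem polya_zero : polya 0 lam = 1 := by
  ext k
  rw [polya_apply, pmf_one_def, PMF.pure_apply]
  cases k with
  | zero => simp
  | succ k => simp [Finset.prod_range_succ']

theorem polya_pow (r : ℝ≥0) (k : ℕ) : polya r lam ^ k = polya (k * r) lam := by
  induction k with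
  | zero => simp [polya_zero]
  | succ k ih =>
    rw [pow_succ, ih, polya_mul_polya]
    push_cast
    ring_nf

/-- The difference of two independent Pólya variables. -/
def polyaDiff (r : ℝ≥0) (lam : Set.Ioo (0 : ℝ) 1) : PMF ℤ :=
  mapHom (Nat.castAddMonoidHom ℤ) (polya r lam) *
    mapHom (-Nat.castAddMonoidHom ℤ) (polya r lam)

theorem polyaDiff_pow (r : ℝ≥0) (k : ℕ) : polyaDiff r lam ^ k = polyaDiff (k * r) lam := by
  rw [polyaDiff, mul_pow, ← map_pow, ← map_pow, polya_pow]
  rfl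

theorem polyaDiff_map_neg (r : ℝ≥0) : (polyaDiff r lam).map (fun v => -v) = polyaDiff r lam := by
  change mapHom (negAddMonoidHom : ℤ →+ ℤ) (polyaDiff r lam) = _
  rw [polyaDiff, map_mul, mapHom_mapHom, mapHom_mapHom, mul_comm,
    show (negAddMonoidHom : ℤ →+ ℤ).comp (-Nat.castAddMonoidHom ℤ) = Nat.castAddMonoidHom ℤ by
      ext; simp]
  rfl

end Polya

/-! ### Pointwise domination -/

section Dominated

/-- `p` is pointwise at most `c` times `q`. -/
def Dominated {α : Type*} (c : ℝ≥0∞) (p q : PMF α) : Prop := ∀ a, p a ≤ c * q a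

variable {α β M N : Type*} [AddCommMonoid M] [AddCommMonoid N]

theorem Dominated.bind {c : ℝ≥0∞} {p q : PMF α} (h : Dominated c p q) (f : α → PMF β) :
    Dominated c (p.bind f) (q.bind f) := fun b => by
  simp only [PMF.bind_apply, ← ENNReal.tsum_mul_left, ← mul_assoc]
  exact ENNReal.tsum_le_tsum fun a => mul_le_mul_left (h a) _

theorem Dominated.map {c : ℝ≥0∞} {p q : PMF α} (h : Dominated c p q) (f : α → β) :
    Dominated c (p.map f) (q.map f) := by
  simp only [← PMF.bind_pure_comp]
  exact h.bind _

theorem Dominated.mul_right {c : ℝ≥0∞} {p q : PMF M} (h : Dominated c p q) (r : PMF M) :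
    Dominated c (p * r) (q * r) := h.bind _

theorem Dominated.mul_left {c : ℝ≥0∞} {p q : PMF M} (h : Dominated c p q) (r : PMF M) :
    Dominated c (r * p) (r * q) := by
  rw [mul_comm r, mul_comm r]
  exact h.mul_right r

theorem Dominated.trans {c c' : ℝ≥0∞} {p q r : PMF α} (h : Dominated c p q)
    (h' : Dominated c' q r) : Dominated (c * c') p r := fun a => by
  rw [mul_assoc]
  exact (h a).trans (mul_le_mul_right (h' a) _)

theorem Dominated.indep {c : ℝ≥0∞} {n : ℕ} {p q : Fin n → PMF β} (i : Fin n)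
    (hi : Dominated c (p i) (q i)) (hj : ∀ j ≠ i, p j = q j) :
    Dominated c (indep p) (indep q) := fun f => by
  rw [indep_apply, indep_apply, ← Finset.mul_prod_erase _ _ (Finset.mem_univ i),
    ← Finset.mul_prod_erase _ (fun j => q j (f j)) (Finset.mem_univ i), ← mul_assoc]
  rw [Finset.prod_congr rfl fun j hj' => by rw [hj j (Finset.ne_of_mem_erase hj')]]
  exact mul_le_mul_left (hi _) _

theorem Dominated.mapHom {c : ℝ≥0∞} {p q : PMF M} (h : Dominated c p q) (f : M →+ N) :
    Dominated c (mapHom f p) (mapHom f q) := h.map f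

variable {lam : Set.Ioo (0 : ℝ) 1}

/-- The ratio of the masses at `k + 1` and `k` is `λ * (r + k) / (k + 1)`, which is at least `λ`
exactly because `r ≥ 1`. The shifted law has no mass at 0. -/
theorem polya_dominated {r : ℝ≥0} (hr : 1 ≤ r) :
    Dominated (ENNReal.ofReal (lam : ℝ)⁻¹) (PMF.pure 1 * polya r lam) (polya r lam) := by
  have hl := lam.2.1
  intro k
  rw [pure_mul_eq_map, PMF.map_apply]
  cases k with
  | zero =>
    have : ∀ a : ℕ, 0 ≠ 1 + a := by omega
    simp [this]
  | succ k =>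
    rw [tsum_eq_single k (by intro a ha; rw [if_neg (by omega)]), if_pos (by omega), polya_apply,
      polya_apply, ← ENNReal.ofReal_mul (inv_nonneg.2 hl.le)]
    refine ENNReal.ofReal_le_ofReal ?_
    have h := polya_mass_nonneg (lam := lam) r k
    have hr' : (1 : ℝ) ≤ r := hr
    have h1 : (1 : ℝ) ≤ ((r : ℝ) + k) / (k + 1) := by
      rw [le_div_iff₀ (by positivity)]
      linarith
    calc _ ≤ ((r : ℝ) + k) / (k + 1) * ((∏ i ∈ Finset.range k, ((r : ℝ) + i) / (i + 1)) *
          (lam : ℝ) ^ k * (1 - (lam : ℝ)) ^ (r : ℝ)) := le_mul_of_one_le_left h h1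
      _ = _ := by
        rw [Finset.prod_range_succ, pow_succ]
        field_simp

theorem polyaDiff_dominated {r : ℝ≥0} (hr : 1 ≤ r) :
    Dominated (ENNReal.ofReal (lam : ℝ)⁻¹) (PMF.pure 1 * polyaDiff r lam) (polyaDiff r lam) := by
  have h := ((polya_dominated (lam := lam) hr).mapHom (Nat.castAddMonoidHom ℤ)).mul_right
    (mapHom (-Nat.castAddMonoidHom ℤ) (polya r lam))
  rwa [map_mul, mapHom_pure, mul_assoc, Nat.coe_castAddMonoidHom, Nat.cast_one] at h

/-- The opposite direction comes from the subtracted Pólya variable: raising it by one shifts the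
difference by `-1`, which cancels the shift by `+1`. -/
theorem polyaDiff_dominated' {r : ℝ≥0} (hr : 1 ≤ r) :
    Dominated (ENNReal.ofReal (lam : ℝ)⁻¹) (polyaDiff r lam) (PMF.pure 1 * polyaDiff r lam) := by
  have h := ((polya_dominated (lam := lam) hr).mapHom (-Nat.castAddMonoidHom ℤ)).mul_left
    (PMF.pure 1 * mapHom (Nat.castAddMonoidHom ℤ) (polya r lam))
  rwa [map_mul, mapHom_pure, mul_assoc, mul_assoc, mul_left_comm (mapHom _ _), ← mul_assoc,
    pure_mul_pure, AddMonoidHom.neg_apply, Nat.coe_castAddMonoidHom, Nat.cast_one,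
    add_neg_cancel, ← pmf_one_def, one_mul] at h

end Dominated

/-! ### Log-likelihood ratios -/

section LLR

/-- If exactly one of the two masses is 0, both sides fail, so the conventions for `log` at 0 and
`∞` agree with the multiplicative form. -/
theorem abs_log_div_le_iff {a b : ℝ≥0∞} (ha : a ≠ ∞) (hb : b ≠ ∞) (h : a ≠ 0 ∨ b ≠ 0) {ε : ℝ}
    (hε : 0 ≤ ε) : (ENNReal.log (a / b)).abs ≤ ENNReal.ofReal ε ↔
      a ≤ ENNReal.ofReal (Real.exp ε) * b ∧ b ≤ ENNReal.ofReal (Real.exp ε) * a := by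
  rcases eq_or_ne a 0 with rfl | ha0
  · have hb0 : b ≠ 0 := by simpa using h
    simp [hb0]
  rcases eq_or_ne b 0 with rfl | hb0
  · simp [ENNReal.div_zero ha0, ha0]
  have ha' := ENNReal.toReal_pos ha0 ha
  have hb' := ENNReal.toReal_pos hb0 hb
  rw [← ENNReal.ofReal_toReal ha, ← ENNReal.ofReal_toReal hb]
  generalize a.toReal = x at ha'
  generalize b.toReal = y at hb'
  have hxy : 0 < x / y := div_pos ha' hb'
  rw [← ENNReal.ofReal_div_of_pos hb', ENNReal.log_ofReal_of_pos hxy, EReal.abs_def,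
    ENNReal.ofReal_le_ofReal_iff hε, ← ENNReal.ofReal_mul (Real.exp_pos _).le,
    ← ENNReal.ofReal_mul (Real.exp_pos _).le, ENNReal.ofReal_le_ofReal_iff (by positivity),
    ENNReal.ofReal_le_ofReal_iff (by positivity), abs_le, and_comm, Real.log_le_iff_le_exp hxy,
    Real.le_log_iff_exp_le hxy, Real.exp_neg, div_le_iff₀ hb', le_div_iff₀ hb',
    inv_mul_le_iff₀ (Real.exp_pos _)]

theorem llrDist_le_iff {Ω : Type*} [MeasurableSpace Ω] (μ ν : Measure Ω) [IsFiniteMeasure μ]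
    [IsFiniteMeasure ν] {ε : ℝ} (hε : 0 ≤ ε) :
    llrDist μ ν ≤ ENNReal.ofReal ε ↔ ∀ E, MeasurableSet E →
      μ E ≤ ENNReal.ofReal (Real.exp ε) * ν E ∧ ν E ≤ ENNReal.ofReal (Real.exp ε) * μ E := by
  simp only [llrDist, iSup_le_iff]
  refine forall₂_congr fun E hE => ?_
  by_cases h : μ E ≠ 0 ∨ ν E ≠ 0
  · simp only [h, true_imp_iff]
    exact abs_log_div_le_iff (measure_ne_top _ _) (measure_ne_top _ _) h hε
  · push Not at h
    simp [h]

end LLR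

/-! ### The randomizer and the intermediary -/

section Mix

variable {A B : Type*}

theorem tsum_map_mul (p : PMF A) (f : A → B) (g : B → ℝ≥0∞) :
    ∑' b, p.map f b * g b = ∑' a, p a * g (f a) := by
  classical
  simp only [PMF.map_apply, ← ENNReal.tsum_mul_right]
  rw [ENNReal.tsum_comm]
  refine tsum_congr fun a => ?_
  rw [tsum_eq_single (f a) fun b hb => by rw [if_neg hb, zero_mul], if_pos rfl]

theorem mix_apply [MeasurableSpace B] (p : PMF A) (κ : A → ProbabilityMeasure B) {E : Set B}
    (hE : MeasurableSet E) : mix p κ E = ∑' a, p a * (κ a : Measure B) E := by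
  simp [mix, Measure.sum_apply _ hE]

instance [MeasurableSpace B] (p : PMF A) (κ : A → ProbabilityMeasure B) :
    IsProbabilityMeasure (mix p κ) :=
  ⟨by simp [mix_apply p κ MeasurableSet.univ, PMF.tsum_coe]⟩

/-- The simulator's output depends on the messages only through `f`, so domination is needed only
for the laws of `f`. Replacing `I` by the simulator and returning costs one factor `exp εhat` each.
The support conditions are there because security is assumed only for at most `n` messages. -/
theorem mix_le_mix_of_dominated {S O : Type*} [MeasurableSpace O] {n : ℕ} {εhat : ℝ}
    (hε : 0 ≤ εhat) {f : List A → S} {I : List A → ProbabilityMeasure O}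
    (hI : LLRSecure εhat n f I) {p q : PMF (List A)} (hp : ∀ y, p y ≠ 0 → y.length ≤ n)
    (hq : ∀ y, q y ≠ 0 → y.length ≤ n) {c : ℝ≥0∞} (h : Dominated c (p.map f) (q.map f))
    {E : Set O} (hE : MeasurableSet E) :
    mix p I E ≤ ENNReal.ofReal (Real.exp εhat) * (c * (ENNReal.ofReal (Real.exp εhat) *
      mix q I E)) := by
  obtain ⟨sim, hsim⟩ := hI
  have hs : ∀ y : List A, y.length ≤ n →
      (I y : Measure O) E ≤ ENNReal.ofReal (Real.exp εhat) * (sim (f y) : Measure O) E ∧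
      (sim (f y) : Measure O) E ≤ ENNReal.ofReal (Real.exp εhat) * (I y : Measure O) E :=
    fun y hy => (llrDist_le_iff _ _ hε).1 (hsim y hy) E hE
  rw [mix_apply _ _ hE, mix_apply _ _ hE]
  calc ∑' y, p y * (I y : Measure O) E
      ≤ ∑' y, ENNReal.ofReal (Real.exp εhat) * (p y * (sim (f y) : Measure O) E) := by
        refine ENNReal.tsum_le_tsum fun y => ?_
        by_cases hy : p y = 0
        · simp [hy]
        · rw [mul_left_comm]
          exact mul_le_mul_right (hs y (hp y hy)).1 _
    _ = ENNReal.ofReal (Real.exp εhat) * ∑' s, p.map f s * (sim s : Measure O) E := by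
        rw [ENNReal.tsum_mul_left, tsum_map_mul p f (fun s => (sim s : Measure O) E)]
    _ ≤ ENNReal.ofReal (Real.exp εhat) * (c * ∑' s, q.map f s * (sim s : Measure O) E) := by
        gcongr
        rw [← ENNReal.tsum_mul_left]
        refine ENNReal.tsum_le_tsum fun s => ?_
        rw [← mul_assoc]
        exact mul_le_mul_left (h s) _
    _ ≤ _ := by
        gcongr
        rw [tsum_map_mul q f (fun s => (sim s : Measure O) E), ← ENNReal.tsum_mul_left]
        refine ENNReal.tsum_le_tsum fun y => ?_
        by_cases hy : q y = 0
        · simp [hy]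
        · rw [mul_left_comm]
          exact mul_le_mul_right (hs y (hq y hy)).2 _

end Mix

/-! ### The local randomizer as a one-hot vector plus noise. -/

section Randomizer

variable {d m n : ℕ} {lam : Set.Ioo (0 : ℝ) 1}

/-- Coordinatewise reduction modulo `m`. -/
def castVec (d m : ℕ) : (Fin d → ℤ) →+ Msg d m := (Int.castAddHom (ZMod m)).compLeft (Fin d)

theorem castVec_apply (v : Fin d → ℤ) (j : Fin d) : castVec d m v j = (v j : ZMod m) := rfl

/-- The indicator vector of `x`. -/
def oneHot (x : Fin d) : Fin d → ℤ := fun j => if x = j then 1 else 0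

/-- Independent Pólya differences in every coordinate. -/
def noise (d : ℕ) (r : ℝ≥0) (lam : Set.Ioo (0 : ℝ) 1) : PMF (Fin d → ℤ) :=
  indep fun _ => polyaDiff r lam

theorem noise_pow (r : ℝ≥0) (k : ℕ) : noise d r lam ^ k = noise d (k * r) lam := by
  change indepHom d ℤ (fun _ => polyaDiff r lam) ^ k = indepHom d ℤ (fun _ => polyaDiff (k * r) lam)
  rw [← map_pow, ← polyaDiff_pow]
  rfl

theorem bern_eq_pure_zero {p : ℝ} (h0 : 0 ≤ p) (h1 : p ≤ 1) (h : p = 0) :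
    bern p h0 h1 = PMF.pure 0 := by
  subst h
  ext k
  rw [bern, PMF.map_apply, tsum_fintype, Fintype.sum_bool, PMF.ofFintype_apply,
    PMF.ofFintype_apply, PMF.pure_apply]
  simp

theorem sumRandomizer_intCast (k : ℤ) :
    sumRandomizer n m 1 lam k =
      mapHom (Int.castAddHom (ZMod m)) (PMF.pure k * polyaDiff (2 / n) lam) := by
  -- An integer input needs no rounding, so the Bernoulli bit is constantly 0.
  have h : Int.fract ((k : ℝ) * (1 : ℕ)) = 0 := by simp
  rw [sumRandomizer, bern_eq_pure_zero _ _ h, PMF.pure_bind]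
  simp only [polyaDiff, pmf_mul_def, mapHom_apply, PMF.pure_bind, PMF.bind_map, PMF.map_bind,
    PMF.map_comp, Function.comp_def]
  refine congrArg _ (funext fun a => congrArg (fun f => PMF.map f _) (funext fun b => ?_))
  simp [sub_eq_add_neg, add_assoc]

theorem utRandomizer_eq (x : Fin d) :
    utRandomizer d n m lam x = mapHom (castVec d m) (PMF.pure (oneHot x)) *
      mapHom (castVec d m) (noise d (2 / n) lam) := by
  have h : ∀ j : Fin d, sumRandomizer n m 1 lam (if x = j then 1 else 0) =
      (PMF.pure (oneHot x j) * polyaDiff (2 / n) lam).map (Int.castAddHom (ZMod m)) := by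
    intro j
    rw [← mapHom_apply, ← sumRandomizer_intCast]
    simp [oneHot]
  rw [← map_mul, utRandomizer]
  simp only [h]
  rw [indep_map, indep_mul, indep_pure]
  rfl

/-- The pure noise law is the intermediate point: removing the one at `a` and inserting the one at
`b` each change a single coordinate, at cost `1 / λ`. -/
theorem noise_dominated {r : ℝ≥0} (hr : 1 ≤ r) (a b : Fin d) :
    Dominated (ENNReal.ofReal (lam : ℝ)⁻¹ * ENNReal.ofReal (lam : ℝ)⁻¹)
      (PMF.pure (oneHot a) * noise d r lam) (PMF.pure (oneHot b) * noise d r lam) := by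
  have h : ∀ a : Fin d, PMF.pure (oneHot a) * noise d r lam =
      indep fun j => PMF.pure (oneHot a j) * polyaDiff r lam := by
    intro a
    rw [indep_mul, indep_pure]
    rfl
  have h0 : ∀ a j : Fin d, j ≠ a → PMF.pure (oneHot a j) * polyaDiff r lam = polyaDiff r lam := by
    intro a j hj
    rw [oneHot, if_neg hj.symm, ← pmf_one_def, one_mul]
  have h1 : ∀ a : Fin d, PMF.pure (oneHot a a) = PMF.pure 1 := by
    intro a
    rw [oneHot, if_pos rfl]
  rw [h, h]
  refine Dominated.trans (q := noise d r lam) ?_ ?_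
  · refine Dominated.indep a ?_ (h0 a)
    rw [h1]
    exact polyaDiff_dominated hr
  · refine Dominated.indep b ?_ fun j hj => (h0 b j hj).symm
    rw [h1]
    exact polyaDiff_dominated' hr

theorem sum_reduceOption {M : Type*} [AddCommMonoid M] (l : List (Option M)) :
    l.reduceOption.sum = (l.map fun o => o.getD 0).sum := by
  induction l with
  | nil => rfl
  | cons o l ih => cases o <;> simp [ih]

end Randomizer

/-! ### Privacy -/

section Privacy

variable {d m n : ℕ} {lam : Set.Ioo (0 : ℝ) 1}

theorem attackedMessages_length {X Y O Z : Type*} [MeasurableSpace O] [MeasurableSpace Z]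
    (P : Protocol n X Y O Z) (T : Attack n Y) (x : Fin n → X) (y : List Y)
    (hy : P.attackedMessages T x y ≠ 0) : y.length ≤ n := by
  obtain ⟨z, -, rfl⟩ := (PMF.mem_support_map_iff _ _ _).1 ((PMF.mem_support_iff _ _).2 hy)
  exact (List.reduceOption_length_le _).trans_eq (List.length_ofFn)

/-- The law of the sum of the messages under an attack. -/
theorem attackedMessages_map_aggregator {O Z : Type*} [MeasurableSpace O] [MeasurableSpace Z]
    (P : Protocol n (Fin d) (Msg d m) O Z) (T : Attack n (Msg d m)) (x : Fin n → Fin d) :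
    (P.attackedMessages T x).map (aggregator d m) = ∏ i,
      if h : i ∈ T.corrupted then PMF.pure ((T.message ⟨i, h⟩).getD 0)
        else P.randomizer i (x i) := by
  rw [Protocol.attackedMessages, PMF.map_comp]
  have : (aggregator d m ∘ fun y : Fin n → Option (Msg d m) => (List.ofFn y).reduceOption) =
      fun y => ∑ i, (y i).getD 0 := by
    funext y
    rw [Function.comp_apply, aggregator, sum_reduceOption, List.map_ofFn, List.sum_ofFn]
    rfl
  rw [this, indep_map_sum_comp _ (fun _ (o : Option (Msg d m)) => o.getD 0)]
  refine Finset.prod_congr rfl fun i _ => ?_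
  split_ifs with h
  · exact PMF.pure_map _ _
  · rw [PMF.map_comp]
    exact PMF.map_id _

theorem attackedMessages_dominated {O Z : Type*} [MeasurableSpace O] [MeasurableSpace Z]
    (P : Protocol n (Fin d) (Msg d m) O Z) (hP : ∀ i, P.randomizer i = utRandomizer d n m lam)
    (T : Attack n (Msg d m)) (hT : 2 * T.corrupted.card ≤ n) {x x' : Fin n → Fin d} {i : Fin n}
    (hi : i ∉ T.corrupted) (hx : ∀ j, j ≠ i → x j = x' j) :
    Dominated (ENNReal.ofReal (lam : ℝ)⁻¹ * ENNReal.ofReal (lam : ℝ)⁻¹)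
      ((P.attackedMessages T x).map (aggregator d m))
      ((P.attackedMessages T x').map (aggregator d m)) := by
  -- User `i`'s datum is collected with all honest noise in one factor; the other factor does not
  -- involve `x i`.
  have key : ∀ x : Fin n → Fin d, (P.attackedMessages T x).map (aggregator d m) =
      mapHom (castVec d m) (PMF.pure (oneHot (x i)) *
        noise d ((n - T.corrupted.card : ℕ) * (2 / n)) lam) *
      ∏ j ∈ Finset.univ.erase i, if h : j ∈ T.corrupted then
        PMF.pure ((T.message ⟨j, h⟩).getD 0)
        else mapHom (castVec d m) (PMF.pure (oneHot (x j))) := by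
    intro x
    have h : ∀ j, (if h : j ∈ T.corrupted then PMF.pure ((T.message ⟨j, h⟩).getD 0)
        else P.randomizer j (x j)) = (if h : j ∈ T.corrupted then
          PMF.pure ((T.message ⟨j, h⟩).getD 0)
          else mapHom (castVec d m) (PMF.pure (oneHot (x j)))) *
        if j ∈ T.corrupted then 1 else mapHom (castVec d m) (noise d (2 / n) lam) := by
      intro j
      split_ifs with h
      · rw [mul_one]
      · rw [hP, utRandomizer_eq]
    rw [attackedMessages_map_aggregator, Finset.prod_congr rfl fun j _ => h j,
      Finset.prod_mul_distrib, ← Finset.mul_prod_erase _ _ (Finset.mem_univ i), dif_neg hi,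
      Finset.prod_ite, Finset.prod_const_one, one_mul, Finset.prod_const, ← map_pow, noise_pow,
      map_mul, mul_right_comm, Finset.filter_not, Finset.filter_mem_eq_inter, Finset.univ_inter,
      Finset.card_sdiff_of_subset (Finset.subset_univ _), Finset.card_univ, Fintype.card_fin]
  rw [key x, key x']
  rw [Finset.prod_congr rfl fun j hj => by rw [hx j (Finset.ne_of_mem_erase hj)]]
  refine ((noise_dominated ?_ _ _).mapHom _).mul_right _
  -- The honest noise has shape `(n - |C|) * 2 / n`, which is at least 1 because at most half of the
  -- users are corrupted.
  have hn : (0 : ℝ≥0) < n := by exact_mod_cast i.pos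
  have : (n : ℝ≥0) ≤ 2 * (n - T.corrupted.card : ℕ) := by exact_mod_cast (by omega)
  rw [← mul_div_assoc, le_div_iff₀ hn, one_mul, mul_comm]
  exact this

/-- The part of the adversary's view that does not come from the intermediary. -/
def knownPart {X Y : Type*} (T : Attack n Y) (x : Fin n → X) : Known n X Y := ⟨T, fun i => x i⟩

theorem view_apply {X Y O Z : Type*} [MeasurableSpace O] [MeasurableSpace Z]
    (P : Protocol n X Y O Z) (T : Attack n Y) (x : Fin n → X) {E : Set (Known n X Y × O)}
    (hE : MeasurableSet E) : P.view T x E =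
      mix (P.attackedMessages T x) P.intermediary (Prod.mk (knownPart T x) ⁻¹' E) :=
  Measure.map_apply measurable_prodMk_left hE

theorem utProtocol_robustlyDP (d n m τ : ℕ) (N ℓ ε εhat : ℝ) (lam : Set.Ioo (0 : ℝ) 1)
    {O : Type*} [MeasurableSpace O] (I : List (Msg d m) → ProbabilityMeasure O)
    (post : Kernel O (Msg d m)) [IsMarkovKernel post] (hε : 0 ≤ ε) (hεhat : 0 ≤ εhat)
    (hlam : (lam : ℝ) = Real.exp (-ε)) (hI : LLRSecure εhat n (aggregator d m) I) :
    (utProtocol d n m τ lam N ℓ I post).RobustlyDP (4 * εhat + 2 * ε) := by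
  intro T hT x x' i hi hx
  set P := utProtocol d n m τ lam N ℓ I post
  have hview : ∀ x x' : Fin n → Fin d, (∀ j, j ≠ i → x j = x' j) →
      ∀ E, MeasurableSet E → P.view T x E ≤
        ENNReal.ofReal (Real.exp (4 * εhat + 2 * ε)) * P.view T x' E := by
    intro x x' hx E hE
    have hk : knownPart T x = knownPart T x' := congrArg (Sigma.mk T)
      (funext fun j => hx j fun h => hi (h ▸ j.2))
    rw [view_apply _ _ _ hE, view_apply _ _ _ hE, hk]
    refine (mix_le_mix_of_dominated hεhat hI (attackedMessages_length P T x)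
      (attackedMessages_length P T x')
      (attackedMessages_dominated (lam := lam) P (fun _ => rfl) T hT hi hx)
      (measurable_prodMk_left hE)).trans ?_
    rw [hlam, ← Real.exp_neg, neg_neg]
    simp only [← mul_assoc]
    refine mul_le_mul_left ?_ _
    simp only [← ENNReal.ofReal_mul (Real.exp_pos _).le, ← Real.exp_add]
    -- The exponent obtained is `2 * εhat + 2 * ε`; the claim is weaker as `εhat ≥ 0`.
    refine ENNReal.ofReal_le_ofReal (Real.exp_le_exp.2 ?_)
    linarith
  have : ∀ x, IsFiniteMeasure (P.view T x) := fun x => by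
    rw [Protocol.view]
    infer_instance
  refine (llrDist_le_iff _ _ (by positivity)).2 fun E hE =>
    ⟨hview x x' hx E hE, hview x' x (fun j hj => (hx j hj).symm) E hE⟩

end Privacy

/-! ### Poissonization -/

section Poissonization

/-- The Poisson distribution as a discrete distribution. -/
def poissonLaw (r : ℝ≥0) : PMF ℕ := (poissonMeasure r).toPMF

theorem poissonLaw_mul_factorial (r : ℝ≥0) (k : ℕ) :
    poissonLaw r k * (k.factorial : ℝ≥0∞) =
      ENNReal.ofReal (Real.exp (-r)) * (r : ℝ≥0∞) ^ k := by
  rw [poissonLaw, Measure.toPMF_apply, poissonMeasure_singleton, ← ENNReal.ofReal_natCast,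
    ← ENNReal.ofReal_mul (by positivity), div_mul_cancel₀ _ (by positivity),
    ENNReal.ofReal_mul (by positivity), ENNReal.ofReal_pow (by positivity),
    ENNReal.ofReal_coe_nnreal]

variable {d : ℕ}

theorem eq_single_add_iff {c b : Fin d → ℕ} {j : Fin d} (hj : c j ≠ 0) :
    c = Pi.single j 1 + b ↔ b = Function.update c j (c j - 1) := by
  simp only [funext_iff, Pi.add_apply, Function.update_apply, Pi.single_apply]
  refine forall_congr' fun k => ?_
  split_ifs with h
  · subst h
    omega
  · omega

theorem prod_update_pred {M : Type*} [CommMonoid M] (F : Fin d → ℕ → M) (c : Fin d → ℕ)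
    (j : Fin d) (k : ℕ) : ∏ i, F i (Function.update c j k i) =
      F j k * ∏ i ∈ Finset.univ.erase j, F i (c i) := by
  rw [← Finset.mul_prod_erase _ _ (Finset.mem_univ j), Function.update_self]
  congr 1
  exact Finset.prod_congr rfl fun i hi => by
    rw [Function.update_of_ne (Finset.ne_of_mem_erase hi)]

/-- The multinomial mass function. -/
theorem map_single_pow_mul_factorial (D : PMF (Fin d)) (n : ℕ) : ∀ c : Fin d → ℕ,
    ((D.map fun j => (Pi.single j 1 : Fin d → ℕ)) ^ n) c * ∏ j, ((c j).factorial : ℝ≥0∞) =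
      if ∑ j, c j = n then (n.factorial : ℝ≥0∞) * ∏ j, D j ^ c j else 0 := by
  induction n with
  | zero =>
    intro c
    change (1 : PMF (Fin d → ℕ)) c * _ = _
    rw [pmf_one_def, PMF.pure_apply]
    by_cases h : c = 0
    · simp [h]
    · rw [if_neg h, zero_mul, if_neg]
      intro h'
      exact h (funext fun j => (Finset.sum_eq_zero_iff.1 h') j (Finset.mem_univ j))
  | succ n ih =>
    intro c
    set E := D.map fun j => (Pi.single j 1 : Fin d → ℕ) with hE
    have hstep : (E ^ (n + 1)) c = ∑ j, D j *
        if c j = 0 then 0 else (E ^ n) (Function.update c j (c j - 1)) := by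
      rw [pow_succ', pmf_mul_def, hE, PMF.bind_map, ← hE, PMF.bind_apply, tsum_fintype]
      refine Finset.sum_congr rfl fun j _ => ?_
      rw [Function.comp_apply, PMF.map_apply]
      congr 1
      split_ifs with hj
      · refine ENNReal.tsum_eq_zero.2 fun b => if_neg fun h => ?_
        have := congrFun h j
        simp at this
        omega
      · simp only [eq_single_add_iff hj]
        rw [tsum_eq_single (Function.update c j (c j - 1)) fun b hb => if_neg hb, if_pos rfl]
    change (E ^ (n + 1)) c * _ = _
    have hterm : ∀ j, D j * (if c j = 0 then 0 else (E ^ n) (Function.update c j (c j - 1))) *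
        ∏ j, ((c j).factorial : ℝ≥0∞) = c j * if ∑ j, c j = n + 1 then
          (n.factorial : ℝ≥0∞) * ∏ j, D j ^ c j else 0 := by
      intro j
      by_cases hj : c j = 0
      · simp [hj]
      obtain ⟨k, hk⟩ := Nat.exists_eq_succ_of_ne_zero hj
      have ih' := ih (Function.update c j (c j - 1))
      change (E ^ n) _ * _ = _ at ih'
      have hsum : ∑ i, Function.update c j (c j - 1) i = n ↔ ∑ j, c j = n + 1 := by
        have h1 : ∑ i, Function.update c j (c j - 1) i = c j - 1 + ∑ i ∈ Finset.univ.erase j, c i := by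
          rw [← Finset.add_sum_erase _ _ (Finset.mem_univ j), Function.update_self,
            Finset.sum_congr rfl fun i hi => by
              rw [Function.update_of_ne (Finset.ne_of_mem_erase hi)]]
        have h2 : ∑ i, c i = c j + ∑ i ∈ Finset.univ.erase j, c i :=
          (Finset.add_sum_erase _ _ (Finset.mem_univ j)).symm
        omega
      rw [prod_update_pred (fun _ k => (k.factorial : ℝ≥0∞)),
        prod_update_pred (fun j k => D j ^ k)] at ih'
      simp only [hsum] at ih'
      rw [if_neg hj, ← Finset.mul_prod_erase _ _ (Finset.mem_univ j),
        ← Finset.mul_prod_erase _ (fun j => D j ^ c j) (Finset.mem_univ j)]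
      rw [hk] at ih' ⊢
      simp only [Nat.succ_eq_add_one, Nat.add_sub_cancel] at ih' ⊢
      calc _ = D j * ((k + 1 : ℕ) : ℝ≥0∞) * ((E ^ n) (Function.update c j k) *
            (k.factorial * ∏ i ∈ Finset.univ.erase j, ((c i).factorial : ℝ≥0∞))) := by
            rw [Nat.factorial_succ]
            push_cast
            ring
        _ = _ := by
            rw [ih']
            split_ifs
            · rw [pow_succ]
              ring
            · simp
    rw [hstep, Finset.sum_mul, Finset.sum_congr rfl fun j _ => hterm j, ← Finset.sum_mul]
    split_ifs with h
    · rw [← Nat.cast_sum, h, Nat.factorial_succ]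
      push_cast
      ring
    · simp

/-- A Poisson number of independent samples has independent Poisson counts. -/
theorem poissonLaw_bind_pow (N : ℝ≥0) (D : PMF (Fin d)) :
    (poissonLaw N).bind (fun n => (D.map fun j => (Pi.single j 1 : Fin d → ℕ)) ^ n) =
      indep fun j => poissonLaw (N * (D j).toNNReal) := by
  ext c
  set E := D.map fun j => (Pi.single j 1 : Fin d → ℕ)
  have hfac : ∏ j, ((c j).factorial : ℝ≥0∞) ≠ 0 :=
    Finset.prod_ne_zero_iff.2 fun j _ => by exact_mod_cast (c j).factorial_ne_zero
  have hfac' : ∏ j, ((c j).factorial : ℝ≥0∞) ≠ ∞ :=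
    ENNReal.prod_ne_top fun j _ => ENNReal.natCast_ne_top _
  refine (ENNReal.mul_left_inj hfac hfac').1 ?_
  have hD : ∀ j, ((D j).toNNReal : ℝ≥0∞) = D j := fun j => ENNReal.coe_toNNReal (D.apply_ne_top j)
  have hD1 : ∑ j, (D j).toReal = 1 := by
    have := D.tsum_coe
    rw [tsum_fintype, Finset.sum_congr rfl fun j _ => (hD j).symm] at this
    simp only [ENNReal.toReal]
    exact_mod_cast this
  have hn : ∀ n, (E ^ n) c * ∏ j, ((c j).factorial : ℝ≥0∞) =
      if ∑ j, c j = n then (n.factorial : ℝ≥0∞) * ∏ j, D j ^ c j else 0 :=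
    fun n => map_single_pow_mul_factorial D n c
  -- Only `n = ∑ j, c j` contributes. Its `n!` cancels against the Poisson mass, and `exp (-N)`
  -- splits over the coordinates because `D` has total mass 1.
  rw [PMF.bind_apply, ← ENNReal.tsum_mul_right, indep_apply, ← Finset.prod_mul_distrib,
    Finset.prod_congr rfl fun j _ => poissonLaw_mul_factorial _ _, Finset.prod_mul_distrib,
    ← ENNReal.ofReal_prod_of_nonneg fun _ _ => (Real.exp_pos _).le, ← Real.exp_sum,
    tsum_eq_single (∑ j, c j) fun n hne => by rw [mul_assoc, hn, if_neg hne.symm, mul_zero],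
    mul_assoc, hn, if_pos rfl, ← mul_assoc, poissonLaw_mul_factorial, mul_assoc]
  congr 2
  · push_cast
    rw [Finset.sum_neg_distrib, ← Finset.mul_sum, hD1, mul_one]
  · simp only [ENNReal.coe_mul, hD, mul_pow, Finset.prod_mul_distrib, Finset.prod_pow_eq_pow_sum]

/-- The histogram of a data set. -/
def hist {n : ℕ} (x : Fin n → Fin d) : Fin d → ℤ := ∑ i, oneHot (x i)

/-- Coordinatewise inclusion of `ℕ` into `ℤ`. -/
def natCastVec (d : ℕ) : (Fin d → ℕ) →+ (Fin d → ℤ) := (Nat.castAddMonoidHom ℤ).compLeft (Fin d)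

theorem natCastVec_single (j : Fin d) : natCastVec d (Pi.single j 1) = oneHot j := by
  funext k
  change ((Pi.single j 1 : Fin d → ℕ) k : ℤ) = if j = k then 1 else 0
  simp [Pi.single_apply, eq_comm]

theorem poissonLaw_bind_hist (N : ℝ≥0) (D : PMF (Fin d)) :
    (poissonLaw N).bind (fun n => (indep fun _ : Fin n => D).map hist) =
      indep fun j => mapHom (Nat.castAddMonoidHom ℤ) (poissonLaw (N * (D j).toNNReal)) := by
  have h : ∀ n : ℕ, (indep fun _ : Fin n => D).map hist =
      ((D.map fun j => (Pi.single j 1 : Fin d → ℕ)) ^ n).map (natCastVec d) := by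
    intro n
    rw [← mapHom_apply, map_pow, mapHom_apply, PMF.map_comp]
    have := indep_map_sum_comp (fun _ : Fin n => D) (fun _ => oneHot)
    rw [Finset.prod_const, Finset.card_univ, Fintype.card_fin] at this
    refine this.trans ?_
    congr 2
    exact funext fun j => (natCastVec_single j).symm
  simp only [h]
  rw [← PMF.map_bind, poissonLaw_bind_pow]
  simp only [mapHom_apply]
  rw [indep_map]
  rfl

end Poissonization

/-! ### Moments -/

section Expectation

variable {α β : Type*} [MeasurableSpace α] [MeasurableSpace β]

/-- `f` is integrable with integral `a`. -/
def HasExp (μ : Measure α) (f : α → ℝ) (a : ℝ) : Prop := Integrable f μ ∧ ∫ x, f x ∂μ = a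

variable {μ : Measure α} {ν : Measure β} {f g : α → ℝ} {a b : ℝ}

theorem HasExp.add (hf : HasExp μ f a) (hg : HasExp μ g b) :
    HasExp μ (fun x => f x + g x) (a + b) :=
  ⟨hf.1.add hg.1, by rw [integral_add hf.1 hg.1, hf.2, hg.2]⟩

theorem HasExp.const_mul (c : ℝ) (hf : HasExp μ f a) : HasExp μ (fun x => c * f x) (c * a) :=
  ⟨hf.1.const_mul c, by rw [integral_const_mul, hf.2]⟩

theorem hasExp_const [IsProbabilityMeasure μ] (c : ℝ) : HasExp μ (fun _ => c) c :=
  ⟨integrable_const c, by simp⟩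

theorem HasExp.prod_mul [SFinite μ] [SFinite ν] {g : β → ℝ} (hf : HasExp μ f a) (hg : HasExp ν g b) :
    HasExp (μ.prod ν) (fun z => f z.1 * g z.2) (a * b) :=
  ⟨hf.1.mul_prod hg.1, by rw [integral_prod_mul, hf.2, hg.2]⟩

theorem HasExp.congr {a' : ℝ} (hf : HasExp μ f a) (h : ∀ x, g x = f x) (ha : a' = a) :
    HasExp μ g a' := by
  rw [funext h, ha]
  exact hf

end Expectation

/-! ### Moments of Poisson counts. -/

section PoissonMoments

theorem cast_descFactorial_succ (n k : ℕ) :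
    (n.descFactorial (k + 1) : ℝ) = ((n : ℝ) - k) * n.descFactorial k := by
  rw [Nat.descFactorial_succ]
  rcases le_or_gt k n with h | h
  · push_cast [h]
    ring
  · rw [Nat.descFactorial_of_lt h]
    simp

theorem hasExp_descFactorial (r : ℝ≥0) (k : ℕ) :
    HasExp (poissonMeasure r) (fun n : ℕ => (n.descFactorial k : ℝ)) ((r : ℝ) ^ k) := by
  have h : HasSum (fun n : ℕ => Real.exp (-r) * (r : ℝ) ^ n / n.factorial * n.descFactorial k)
      ((r : ℝ) ^ k) := by
    -- The falling factorial vanishes below `k`; after shifting by `k` the series is `r ^ k` times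
    -- the total Poisson mass.
    rw [← hasSum_nat_add_iff' k, Finset.sum_eq_zero fun i hi => by
      rw [Nat.descFactorial_of_lt (Finset.mem_range.1 hi)]; simp, sub_zero]
    have h1 := (hasSum_one_poissonMeasure r).mul_left ((r : ℝ) ^ k)
    rw [mul_one] at h1
    refine h1.congr_fun fun n => ?_
    have h2 : ((n + k).factorial : ℝ) = n.factorial * (n + k).descFactorial k := by
      have := Nat.factorial_mul_descFactorial (Nat.le_add_left k n)
      rw [Nat.add_sub_cancel] at this
      exact_mod_cast this.symm
    have h3 : (0 : ℝ) < (n + k).descFactorial k := by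
      exact_mod_cast Nat.descFactorial_pos.2 (Nat.le_add_left k n)
    rw [h2, pow_add]
    field_simp
  refine ⟨integrable_poissonMeasure_iff.2 ?_, ?_⟩
  · refine h.summable.congr fun n => ?_
    rw [Real.norm_of_nonneg (by positivity)]
  · rw [integral_poissonMeasure]
    simpa only [smul_eq_mul] using h.tsum_eq

/-- The first two moments of `(c - b) ^ 2 - c` and of `2 * (c - b) - 1` for a Poisson `c`. -/
theorem poisson_moments (r : ℝ≥0) (b : ℝ) :
    HasExp (poissonMeasure r) (fun c : ℕ => ((c : ℝ) - b) ^ 2 - c) ((r - b) ^ 2) ∧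
    HasExp (poissonMeasure r) (fun c : ℕ => (((c : ℝ) - b) ^ 2 - c) ^ 2)
      ((r - b) ^ 4 + 2 * (r : ℝ) ^ 2 + 4 * r * (r - b) ^ 2) ∧
    HasExp (poissonMeasure r) (fun c : ℕ => 2 * ((c : ℝ) - b) - 1) (2 * (r - b) - 1) ∧
    HasExp (poissonMeasure r) (fun c : ℕ => (2 * ((c : ℝ) - b) - 1) ^ 2)
      (4 * (r - b) ^ 2 + 4 * b + 1) ∧
    HasExp (poissonMeasure r) (fun c : ℕ => (((c : ℝ) - b) ^ 2 - c) * (2 * ((c : ℝ) - b) - 1))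
      (2 * r ^ 3 + (3 - 6 * b) * r ^ 2 + (6 * b ^ 2 - 2 * b) * r - (2 * b ^ 3 + b ^ 2)) := by
  have h0 := hasExp_const (μ := poissonMeasure r) 1
  have h1 := hasExp_descFactorial r 1
  have h2 := hasExp_descFactorial r 2
  have h3 := hasExp_descFactorial r 3
  have h4 := hasExp_descFactorial r 4
  refine ⟨((h2.add (h1.const_mul (-2 * b))).add (h0.const_mul (b ^ 2))).congr ?_ ?_,
    ((((h4.add (h3.const_mul (4 - 4 * b))).add (h2.const_mul (2 + 6 * b ^ 2 - 8 * b))).add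
      (h1.const_mul (4 * b ^ 2 - 4 * b ^ 3))).add (h0.const_mul (b ^ 4))).congr ?_ ?_,
    ((h1.const_mul 2).add (h0.const_mul (-2 * b - 1))).congr ?_ ?_,
    (((h2.const_mul 4).add (h1.const_mul (-8 * b))).add (h0.const_mul ((2 * b + 1) ^ 2))).congr
      ?_ ?_,
    ((((h3.const_mul 2).add (h2.const_mul (3 - 6 * b))).add (h1.const_mul (6 * b ^ 2 - 2 * b))).add
      (h0.const_mul (-(2 * b ^ 3 + b ^ 2)))).congr ?_ ?_⟩
  all_goals first
    | intro c
      simp only [cast_descFactorial_succ, Nat.descFactorial_zero]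
      push_cast
      ring
    | ring

end PoissonMoments

/-! ### Moments of the Pólya noise. -/

section NoiseMoments

variable {lam : Set.Ioo (0 : ℝ) 1}

theorem tsum_pmf_mul {M : Type*} [AddCommMonoid M] (p q : PMF M) (g : M → ℝ≥0∞) :
    ∑' v, (p * q) v * g v = ∑' a, p a * ∑' b, q b * g (a + b) := by
  simp only [pmf_mul_def, PMF.bind_apply, ← ENNReal.tsum_mul_right]
  rw [ENNReal.tsum_comm]
  refine tsum_congr fun a => ?_
  simp only [mul_assoc, ENNReal.tsum_mul_left]
  rw [tsum_map_mul]

theorem lintegral_toMeasure {α : Type*} [MeasurableSpace α] [Countable α]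
    [MeasurableSingletonClass α] (p : PMF α) (g : α → ℝ≥0∞) :
    ∫⁻ a, g a ∂p.toMeasure = ∑' a, p a * g a := by
  rw [lintegral_countable']
  refine tsum_congr fun a => ?_
  rw [PMF.toMeasure_apply_singleton _ _ (measurableSet_singleton a), mul_comm]

theorem polya_two_apply (a : ℕ) :
    polya 2 lam a = ENNReal.ofReal ((a + 1) * (lam : ℝ) ^ a * (1 - (lam : ℝ)) ^ 2) := by
  have h : ∀ a : ℕ, ∏ i ∈ Finset.range a, ((2 : ℝ) + i) / (i + 1) = a + 1 := by
    intro a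
    induction a with
    | zero => simp
    | succ a ih =>
      rw [Finset.prod_range_succ, ih]
      push_cast
      field_simp
      ring
  rw [polya_apply, NNReal.coe_ofNat, h, Real.rpow_ofNat]

/-- The factor `(a + 1) * a ^ k` is at most the rising factorial `(a + 1) ⋯ (a + k + 1)`, and the
resulting negative binomial series sums to a multiple of `(1 - λ) ^ (-(k + 2))`. -/
theorem polya_two_moment_le (k : ℕ) :
    ∑' a : ℕ, polya 2 lam a * ENNReal.ofReal ((a : ℝ) ^ k) ≤
      ENNReal.ofReal ((k + 1).factorial / (1 - (lam : ℝ)) ^ k) := by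
  obtain ⟨hl0, hl1⟩ := lam.2
  have h1 : (0 : ℝ) < 1 - lam := by linarith
  have hnorm : ‖(lam : ℝ)‖ < 1 := by rwa [Real.norm_of_nonneg hl0.le]
  have hs := (summable_choose_mul_geometric_of_norm_lt_one (k + 1) hnorm).mul_left
    ((k + 1).factorial * (1 - (lam : ℝ)) ^ 2)
  have ht := tsum_choose_mul_geometric_of_norm_lt_one (k + 1) hnorm
  calc _ ≤ ∑' a : ℕ, ENNReal.ofReal ((k + 1).factorial * (1 - (lam : ℝ)) ^ 2 *
        ((a + (k + 1)).choose (k + 1) * (lam : ℝ) ^ a)) := by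
        refine ENNReal.tsum_le_tsum fun a => ?_
        rw [polya_two_apply, ← ENNReal.ofReal_mul (by positivity)]
        refine ENNReal.ofReal_le_ofReal ?_
        have h2 : ((a : ℝ) + 1) * (a : ℝ) ^ k ≤ (k + 1).factorial * (a + (k + 1)).choose (k + 1) := by
          have h3 := Nat.pow_succ_le_ascFactorial a.succ (k + 1)
          rw [Nat.ascFactorial_eq_factorial_mul_choose] at h3
          calc ((a : ℝ) + 1) * (a : ℝ) ^ k ≤ (a + 1) * (a + 1) ^ k := by gcongr; linarith
            _ = ((a + 1 : ℕ) ^ (k + 1) : ℕ) := by push_cast; ring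
            _ ≤ _ := by exact_mod_cast h3
        calc _ = ((a : ℝ) + 1) * (a : ℝ) ^ k * ((1 - (lam : ℝ)) ^ 2 * (lam : ℝ) ^ a) := by ring
          _ ≤ (k + 1).factorial * (a + (k + 1)).choose (k + 1) *
              ((1 - (lam : ℝ)) ^ 2 * (lam : ℝ) ^ a) :=
            mul_le_mul_of_nonneg_right h2 (by positivity)
          _ = _ := by ring
    _ = _ := by
        rw [← ENNReal.ofReal_tsum_of_nonneg (fun a => by positivity) hs, tsum_mul_left, ht]
        congr 1
        rw [show k + 1 + 1 = k + 2 from rfl, pow_add]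
        field_simp

theorem abs_sub_pow_le (a b : ℕ) (k : ℕ) : |(a : ℝ) - b| ^ k ≤ (a : ℝ) ^ k + (b : ℝ) ^ k := by
  have ha : (0 : ℝ) ≤ a := Nat.cast_nonneg a
  have hb : (0 : ℝ) ≤ b := Nat.cast_nonneg b
  rcases le_total (a : ℝ) b with h | h
  · have : |(a : ℝ) - b| ≤ b := abs_le.2 ⟨by linarith, by linarith⟩
    exact (pow_le_pow_left₀ (abs_nonneg _) this k).trans (le_add_of_nonneg_left (by positivity))
  · have : |(a : ℝ) - b| ≤ a := abs_le.2 ⟨by linarith, by linarith⟩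
    exact (pow_le_pow_left₀ (abs_nonneg _) this k).trans (le_add_of_nonneg_right (by positivity))

theorem lintegral_polyaDiff_two_le (k : ℕ) :
    ∫⁻ v, ENNReal.ofReal (|(v : ℝ)| ^ k) ∂(polyaDiff 2 lam).toMeasure ≤
      ENNReal.ofReal (2 * (k + 1).factorial / (1 - (lam : ℝ)) ^ k) := by
  have h1 : (0 : ℝ) < 1 - lam := by linarith [lam.2.2]
  rw [lintegral_toMeasure, polyaDiff, tsum_pmf_mul, mapHom_apply, mapHom_apply,
    tsum_map_mul _ _ (fun a : ℤ => ∑' b, (polya 2 lam).map (-Nat.castAddMonoidHom ℤ) b *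
      ENNReal.ofReal (|((a + b : ℤ) : ℝ)| ^ k))]
  calc _ ≤ ∑' a : ℕ, polya 2 lam a * ∑' b : ℕ, polya 2 lam b *
        (ENNReal.ofReal ((a : ℝ) ^ k) + ENNReal.ofReal ((b : ℝ) ^ k)) := by
        refine ENNReal.tsum_le_tsum fun a => mul_le_mul_right ?_ _
        rw [tsum_map_mul _ _ (fun b : ℤ => ENNReal.ofReal
          (|((Nat.castAddMonoidHom ℤ a + b : ℤ) : ℝ)| ^ k))]
        refine ENNReal.tsum_le_tsum fun b => mul_le_mul_right ?_ _
        rw [← ENNReal.ofReal_add (by positivity) (by positivity)]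
        refine ENNReal.ofReal_le_ofReal ((le_of_eq ?_).trans (abs_sub_pow_le a b k))
        simp [sub_eq_add_neg]
    _ = ∑' a : ℕ, polya 2 lam a * ENNReal.ofReal ((a : ℝ) ^ k) +
        ∑' a : ℕ, polya 2 lam a * ENNReal.ofReal ((a : ℝ) ^ k) := by
        simp only [mul_add, ENNReal.tsum_add, ENNReal.tsum_mul_right, PMF.tsum_coe, one_mul]
    _ ≤ _ := by
        refine (add_le_add (polya_two_moment_le k) (polya_two_moment_le k)).trans_eq ?_
        rw [← ENNReal.ofReal_add (by positivity) (by positivity)]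
        congr 1
        ring

theorem integrable_abs_pow_polyaDiff (k : ℕ) :
    Integrable (fun v : ℤ => |(v : ℝ)| ^ k) (polyaDiff 2 lam).toMeasure := by
  refine ⟨Measurable.of_discrete.aestronglyMeasurable, ?_⟩
  rw [hasFiniteIntegral_iff_ofReal (ae_of_all _ fun v => by positivity)]
  exact (lintegral_polyaDiff_two_le k).trans_lt ENNReal.ofReal_lt_top

theorem integrable_pow_polyaDiff (k : ℕ) :
    Integrable (fun v : ℤ => (v : ℝ) ^ k) (polyaDiff 2 lam).toMeasure :=
  (integrable_abs_pow_polyaDiff k).mono' Measurable.of_discrete.aestronglyMeasurable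
    (ae_of_all _ fun v => by rw [norm_pow, Real.norm_eq_abs])

theorem integral_abs_pow_polyaDiff_le (k : ℕ) :
    ∫ v, |(v : ℝ)| ^ k ∂(polyaDiff 2 lam).toMeasure ≤
      2 * (k + 1).factorial / (1 - (lam : ℝ)) ^ k := by
  have h1 : (0 : ℝ) < 1 - lam := by linarith [lam.2.2]
  rw [integral_eq_lintegral_of_nonneg_ae (ae_of_all _ fun v => by positivity)
    Measurable.of_discrete.aestronglyMeasurable]
  exact ENNReal.toReal_le_of_le_ofReal (by positivity) (lintegral_polyaDiff_two_le k)

theorem hasExp_odd_polyaDiff {k : ℕ} (hk : Odd k) :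
    HasExp (polyaDiff 2 lam).toMeasure (fun v : ℤ => (v : ℝ) ^ k) 0 := by
  refine ⟨integrable_pow_polyaDiff k, ?_⟩
  have h : ∫ v, (v : ℝ) ^ k ∂(polyaDiff 2 lam).toMeasure =
      -∫ v, (v : ℝ) ^ k ∂(polyaDiff 2 lam).toMeasure := by
    conv_lhs => rw [← polyaDiff_map_neg, ← PMF.toMeasure_map _ _ Measurable.of_discrete,
      integral_map Measurable.of_discrete.aemeasurable
        Measurable.of_discrete.aestronglyMeasurable]
    simp only [Int.cast_neg, hk.neg_pow, integral_neg]
  linarith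

/-- The variance of the noise in each coordinate. -/
def noiseVar (lam : Set.Ioo (0 : ℝ) 1) : ℝ := ∫ v, (v : ℝ) ^ 2 ∂(polyaDiff 2 lam).toMeasure

theorem noiseVar_le : noiseVar lam ≤ 12 / (1 - (lam : ℝ)) ^ 2 := by
  have := integral_abs_pow_polyaDiff_le (lam := lam) 2
  simp only [sq_abs] at this
  refine this.trans_eq ?_
  norm_num [Nat.factorial]

theorem integral_pow_four_polyaDiff_le :
    ∫ v, (v : ℝ) ^ 4 ∂(polyaDiff 2 lam).toMeasure ≤ 240 / (1 - (lam : ℝ)) ^ 4 := by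
  have := integral_abs_pow_polyaDiff_le (lam := lam) 4
  simp only [Even.pow_abs (⟨2, rfl⟩ : Even 4)] at this
  refine this.trans_eq ?_
  norm_num [Nat.factorial]

end NoiseMoments

/-! ### Mean and variance of one term of the statistic. -/

section Coordinate

variable {lam : Set.Ioo (0 : ℝ) 1}

theorem toMeasure_pmf_mul (p : PMF ℕ) (q : PMF ℤ) :
    (mapHom (Nat.castAddMonoidHom ℤ) p * q).toMeasure =
      (p.toMeasure.prod q.toMeasure).map fun z => (z.1 : ℤ) + z.2 := by
  ext s hs
  rw [Measure.map_apply Measurable.of_discrete hs,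
    Measure.prod_apply (MeasurableSet.of_discrete), lintegral_toMeasure, pmf_mul_def,
    mapHom_apply, PMF.bind_map, PMF.toMeasure_bind_apply _ _ _ hs]
  refine tsum_congr fun a => ?_
  rw [Function.comp_apply, PMF.toMeasure_map_apply _ _ _ Measurable.of_discrete hs]
  rfl

/-- The law of a Poisson count plus noise. -/
def noisyCount (r : ℝ≥0) (lam : Set.Ioo (0 : ℝ) 1) : PMF ℤ :=
  mapHom (Nat.castAddMonoidHom ℤ) (poissonLaw r) * polyaDiff 2 lam

/-- The contribution of one coordinate to the statistic. -/
def chiTerm (b : ℝ) (k : ℤ) : ℝ := (k - b) ^ 2 - k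

/-- For a count `c` and noise `v`, the term equals `A + B * v + v ^ 2` with `A = (c - b) ^ 2 - c`
and `B = 2 * (c - b) - 1`. The noise is symmetric and independent of `c`, so odd powers of `v` drop
out of both moments; subtracting `c` makes the mean of `A` exactly `(r - b) ^ 2`. -/
theorem chiTerm_moments (r : ℝ≥0) (b : ℝ) :
    MemLp (chiTerm b) 2 (noisyCount r lam).toMeasure ∧
    ∫ k, chiTerm b k ∂(noisyCount r lam).toMeasure = (r - b) ^ 2 + noiseVar lam ∧
    Var[chiTerm b; (noisyCount r lam).toMeasure] ≤ 2 * (r : ℝ) ^ 2 + 4 * r * (r - b) ^ 2 +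
      (4 * (r - b) ^ 2 + 4 * b + 1) * noiseVar lam + 240 / (1 - (lam : ℝ)) ^ 4 := by
  set ν := (polyaDiff 2 lam).toMeasure with hν
  have hlaw : (noisyCount r lam).toMeasure =
      ((poissonMeasure r).prod ν).map fun z => (z.1 : ℤ) + z.2 := by
    rw [noisyCount, toMeasure_pmf_mul, poissonLaw, Measure.toPMF_toMeasure]
  obtain ⟨hA, hA2, hB, hB2, hAB⟩ := poisson_moments r b
  have h0 := hasExp_const (μ := poissonMeasure r) 1
  have h0' := hasExp_const (μ := ν) 1
  have h1 : HasExp ν (fun v : ℤ => (v : ℝ) ^ 1) 0 := hasExp_odd_polyaDiff odd_one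
  have h2 : HasExp ν (fun v : ℤ => (v : ℝ) ^ 2) (noiseVar lam) := ⟨integrable_pow_polyaDiff 2, rfl⟩
  have h3 : HasExp ν (fun v : ℤ => (v : ℝ) ^ 3) 0 := hasExp_odd_polyaDiff ⟨1, rfl⟩
  have h4 : HasExp ν (fun v : ℤ => (v : ℝ) ^ 4) (∫ v, (v : ℝ) ^ 4 ∂ν) :=
    ⟨integrable_pow_polyaDiff 4, rfl⟩
  have hT : HasExp ((poissonMeasure r).prod ν) (fun z => chiTerm b ((z.1 : ℤ) + z.2))
      ((r - b) ^ 2 + noiseVar lam) := by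
    refine (((hA.prod_mul h0').add (h0.prod_mul h2)).add (hB.prod_mul h1)).congr ?_ (by ring)
    intro z
    simp only [chiTerm]
    push_cast
    ring
  have hT2 : HasExp ((poissonMeasure r).prod ν) (fun z => chiTerm b ((z.1 : ℤ) + z.2) ^ 2)
      ((r - b) ^ 4 + 2 * (r : ℝ) ^ 2 + 4 * r * (r - b) ^ 2 + ∫ v, (v : ℝ) ^ 4 ∂ν +
        (4 * (r - b) ^ 2 + 4 * b + 1) * noiseVar lam + 2 * ((r - b) ^ 2 * noiseVar lam)) := by
    -- The value of `hAB` is multiplied by the vanishing mean of `v`; only its integrability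
    -- matters.
    refine ((((((hA2.prod_mul h0').add (h0.prod_mul h4)).add (hB2.prod_mul h2)).add
      ((hA.prod_mul h2).const_mul 2)).add ((hAB.prod_mul h1).const_mul 2)).add
      ((hB.prod_mul h3).const_mul 2)).congr ?_ (by ring)
    intro z
    simp only [chiTerm]
    push_cast
    ring
  have hm : AEMeasurable (fun z : ℕ × ℤ => (z.1 : ℤ) + z.2) ((poissonMeasure r).prod ν) :=
    Measurable.of_discrete.aemeasurable
  have hs : ∀ f : ℤ → ℝ, AEStronglyMeasurable f
      (((poissonMeasure r).prod ν).map fun z => (z.1 : ℤ) + z.2) :=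
    fun f => Measurable.of_discrete.aestronglyMeasurable
  have hL : MemLp (chiTerm b) 2 (noisyCount r lam).toMeasure := by
    rw [hlaw, memLp_two_iff_integrable_sq (hs _)]
    exact (integrable_map_measure (hs _) hm).2 hT2.1
  have hI : ∫ k, chiTerm b k ∂(noisyCount r lam).toMeasure = (r - b) ^ 2 + noiseVar lam := by
    rw [hlaw, integral_map hm (hs _), hT.2]
  refine ⟨hL, hI, ?_⟩
  rw [variance_eq_sub hL, hI]
  simp only [Pi.pow_apply]
  rw [hlaw, integral_map hm (hs _), hT2.2]
  have := integral_pow_four_polyaDiff_le (lam := lam)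
  nlinarith [sq_nonneg (noiseVar lam)]

end Coordinate

/-! ### Sums over independent coordinates. -/

section Product

theorem toMeasure_indep {β : Type*} [MeasurableSpace β] {n : ℕ} (p : Fin n → PMF β) :
    (indep p).toMeasure = Measure.pi fun i => (p i).toMeasure := by
  refine (Measure.pi_eq fun s hs => ?_).symm
  rw [PMF.toMeasure_apply _ (MeasurableSet.univ_pi hs),
    Finset.prod_congr rfl fun i _ => PMF.toMeasure_apply _ (hs i), ← tsum_pi_prod]
  refine tsum_congr fun f => ?_
  by_cases hf : f ∈ Set.univ.pi s
  · rw [Set.indicator_of_mem hf, indep_apply]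
    exact Finset.prod_congr rfl fun i _ => (Set.indicator_of_mem (hf i (Set.mem_univ i)) _).symm
  · rw [Set.indicator_of_notMem hf]
    simp only [Set.mem_univ_pi, not_forall] at hf
    obtain ⟨i, hi⟩ := hf
    exact (Finset.prod_eq_zero (Finset.mem_univ i) (Set.indicator_of_notMem hi _)).symm

theorem pi_memLp_sum {n : ℕ} {β : Type*} [MeasurableSpace β] {μ : Fin n → Measure β}
    [∀ i, IsProbabilityMeasure (μ i)] {X : Fin n → β → ℝ} (h : ∀ i, MemLp (X i) 2 (μ i)) :
    MemLp (∑ i, fun ω : Fin n → β => X i (ω i)) 2 (Measure.pi μ) ∧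
    ∫ ω, (∑ i, fun ω : Fin n → β => X i (ω i)) ω ∂Measure.pi μ = ∑ i, ∫ x, X i x ∂μ i := by
  have hL : ∀ i, MemLp (fun ω : Fin n → β => X i (ω i)) 2 (Measure.pi μ) := fun i =>
    (h i).comp_measurePreserving (measurePreserving_eval _ i)
  refine ⟨memLp_finsetSum' _ fun i _ => hL i, ?_⟩
  simp only [Finset.sum_apply]
  rw [integral_finsetSum _ fun i _ => (hL i).integrable (by norm_num)]
  refine Finset.sum_congr rfl fun i _ => ?_
  have := (measurePreserving_eval μ i).map_eq
  conv_rhs => rw [← this]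
  rw [integral_map (measurable_pi_apply i).aemeasurable]
  change AEStronglyMeasurable (X i) (Measure.map (Function.eval i) (Measure.pi μ))
  rw [this]
  exact (h i).aestronglyMeasurable

end Product

/-! ### Concentration of the statistic -/

section Concentration

theorem sum_variance_bound {d : ℕ} (b v κ : ℝ) (r : Fin d → ℝ) :
    ∑ j, (2 * r j ^ 2 + 4 * r j * (r j - b) ^ 2 + (4 * (r j - b) ^ 2 + 4 * b + 1) * v + κ) ≤
      4 * d * b ^ 2 + 4 * ∑ j, (r j - b) ^ 2 + 4 * b * ∑ j, (r j - b) ^ 2 +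
        4 * √(∑ j, (r j - b) ^ 2) * ∑ j, (r j - b) ^ 2 +
        (4 * ∑ j, (r j - b) ^ 2 + 4 * d * b + d) * v + d * κ := by
  set S := ∑ j, (r j - b) ^ 2 with hS
  have hle : ∀ j, r j - b ≤ √S := fun j => by
    refine (le_abs_self _).trans (Real.abs_le_sqrt ?_)
    exact Finset.single_le_sum (f := fun j => (r j - b) ^ 2) (fun _ _ => sq_nonneg _)
      (Finset.mem_univ j)
  -- Here `2 * r ^ 2 ≤ 4 * b ^ 2 + 4 * (r - b) ^ 2`, and one factor of the cube `(r - b) ^ 3` is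
  -- bounded by `√S`.
  calc _ ≤ ∑ j, ((4 * b ^ 2 + 4 * b * v + v + κ) +
        (4 + 4 * b + 4 * √S + 4 * v) * (r j - b) ^ 2) := by
        refine Finset.sum_le_sum fun j _ => ?_
        have := mul_le_mul_of_nonneg_right (hle j) (sq_nonneg (r j - b))
        nlinarith [sq_nonneg (r j - 2 * b)]
    _ = _ := by
        rw [Finset.sum_add_distrib, ← Finset.mul_sum, ← hS]
        simp
        ring

/-- `M` is the scale to be resolved: it bounds `S` and is at least `s`. `h2` controls `N ^ 2 / d`,
`h3` controls `N / ε ^ 2`, and `h4` controls `d / ε ^ 4`. The largest contributions are `4 * (N / d)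
* S` and `4 * √S * S`, each at most `4 * M ^ 2 / 1000`, so 40 leaves room. -/
theorem variance_le_sq_div {d N α ε S M v κ : ℝ} (hd : 1 ≤ d) (hN : 0 < N) (hα : 0 < α)
    (hα1 : α < 1) (hε : 0 < ε) (hε1 : ε < 1) (h2 : 1000 ^ 2 * d ≤ N ^ 2 * α ^ 4)
    (h3 : 1000 ^ 3 * d ^ 2 ≤ N ^ 3 * α ^ 4 * ε ^ 2) (h4 : 1000 ^ 4 * d ^ 3 ≤ N ^ 4 * α ^ 4 * ε ^ 4)
    (hv : v ≤ 48 / ε ^ 2) (hκ : κ ≤ 3840 / ε ^ 4) (hS : 0 ≤ S) (hSM : S ≤ M)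
    (hM : α ^ 2 * N ^ 2 / d ≤ M) :
    4 * d * (N / d) ^ 2 + 4 * S + 4 * (N / d) * S + 4 * √S * S +
      (4 * S + 4 * d * (N / d) + d) * v + d * κ ≤ M ^ 2 / 40 := by
  have hd0 : 0 < d := by linarith
  set s := α ^ 2 * N ^ 2 / d with hs
  have hs0 : 0 < s := by positivity
  have hM0 : 0 < M := hs0.trans_le hM
  have hsM : s ^ 2 ≤ M ^ 2 := pow_le_pow_left₀ hs0.le hM 2
  have hs2 : s ^ 2 = α ^ 4 * N ^ 4 / d ^ 2 := by rw [hs]; ring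
  have e1 : d * (N / d) ^ 2 ≤ M ^ 2 / 1000 ^ 2 := by
    refine le_trans ?_ (div_le_div_of_nonneg_right hsM (by positivity))
    rw [hs2, div_pow, mul_div_assoc', div_div, div_le_div_iff₀ (by positivity) (by positivity)]
    have := mul_le_mul_of_nonneg_left h2 (show 0 ≤ N ^ 2 * d ^ 2 by positivity)
    nlinarith
  have hα4 : α ^ 4 ≤ α ^ 2 := pow_le_pow_of_le_one hα.le hα1.le (by norm_num)
  have e2 : 1000 ^ 2 ≤ M := by
    refine le_trans ?_ hM
    rw [hs, le_div_iff₀ hd0]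
    have := mul_le_mul_of_nonneg_left hα4 (sq_nonneg N)
    linarith
  have hNα : 1000 ≤ α ^ 2 * N := by
    refine (abs_le_of_sq_le_sq' ?_ (by positivity)).2
    have : (α ^ 2 * N) ^ 2 = N ^ 2 * α ^ 4 := by ring
    linarith
  have e3 : N / d ≤ M / 1000 := by
    refine le_trans ?_ (div_le_div_of_nonneg_right hM (by positivity))
    rw [hs, div_div, div_le_div_iff₀ (by positivity) (by positivity)]
    have := mul_le_mul_of_nonneg_left hNα (show 0 ≤ N * d by positivity)
    nlinarith
  have e4 : N / ε ^ 2 ≤ M ^ 2 / 1000 ^ 3 := by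
    refine le_trans ?_ (div_le_div_of_nonneg_right hsM (by positivity))
    rw [hs2, div_div, div_le_div_iff₀ (by positivity) (by positivity)]
    have := mul_le_mul_of_nonneg_left h3 hN.le
    nlinarith
  have e6 : d / ε ^ 4 ≤ M ^ 2 / 1000 ^ 4 := by
    refine le_trans ?_ (div_le_div_of_nonneg_right hsM (by positivity))
    rw [hs2, div_div, div_le_div_iff₀ (by positivity) (by positivity)]
    nlinarith
  have e5 : 1 / ε ^ 2 ≤ M / 1000 ^ 2 := by
    refine (abs_le_of_sq_le_sq' ?_ (by positivity)).2
    calc (1 / ε ^ 2) ^ 2 = 1 / ε ^ 4 := by ring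
      _ ≤ d / ε ^ 4 := by gcongr
      _ ≤ M ^ 2 / 1000 ^ 4 := e6
      _ = _ := by ring
  have hsqrt : √S ≤ M / 1000 := by
    refine Real.sqrt_le_iff.2 ⟨by positivity, hSM.trans ?_⟩
    rw [div_pow, le_div_iff₀ (by norm_num)]
    nlinarith
  have t2 : S ≤ M ^ 2 / 1000 ^ 2 := by
    rw [le_div_iff₀ (by norm_num)]
    nlinarith
  have t3 : N / d * S ≤ M / 1000 * M := mul_le_mul e3 hSM hS (by positivity)
  have t4 : √S * S ≤ M / 1000 * M := mul_le_mul hsqrt hSM hS (by positivity)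
  have t5 : S / ε ^ 2 ≤ M ^ 2 / 1000 ^ 2 := by
    calc S / ε ^ 2 = S * (1 / ε ^ 2) := by ring
      _ ≤ M * (M / 1000 ^ 2) := mul_le_mul hSM e5 (by positivity) hM0.le
      _ = _ := by ring
  have t6 : d / ε ^ 2 ≤ d / ε ^ 4 :=
    div_le_div_of_nonneg_left hd0.le (by positivity)
      (pow_le_pow_of_le_one hε.le hε1.le (by norm_num))
  have hv' : (4 * S + 4 * d * (N / d) + d) * v ≤
      192 * (S / ε ^ 2) + 192 * (N / ε ^ 2) + 48 * (d / ε ^ 2) := by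
    refine (mul_le_mul_of_nonneg_left hv (by positivity)).trans_eq ?_
    field_simp
    ring
  have hκ' : d * κ ≤ 3840 * (d / ε ^ 4) := by
    refine (mul_le_mul_of_nonneg_left hκ hd0.le).trans_eq ?_
    ring
  nlinarith [sq_nonneg M]

theorem half_le_one_sub_exp_neg {ε : ℝ} (hε : 0 < ε) (hε1 : ε < 1) :
    ε / 2 ≤ 1 - Real.exp (-ε) := by
  have h := Real.add_one_le_exp ε
  have h1 : Real.exp (-ε) ≤ 1 / (1 + ε) := by
    rw [Real.exp_neg, inv_eq_one_div]
    exact one_div_le_one_div_of_le (by linarith) (by linarith)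
  have h2 : 1 / (1 + ε) ≤ 1 - ε / 2 := by
    rw [div_le_iff₀ (by linarith)]
    nlinarith
  linarith

/-- The sum of squared deviations of the expected counts from the uniform ones. -/
def sqDev {d : ℕ} (N : ℝ≥0) (D : PMF (Fin d)) : ℝ :=
  ∑ j, ((N : ℝ) * (D j).toReal - N / d) ^ 2

/-- Chebyshev at distance `M / 2`: variance at most `M ^ 2 / 40` gives probability at most `1 / 10`.
`M` stays free since it is `s` for the uniform distribution and `sqDev N D` for a far one. -/
theorem noisyCounts_concentration {d : ℕ} [NeZero d] {N : ℝ≥0} {α ε M : ℝ}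
    {lam : Set.Ioo (0 : ℝ) 1} (hN : 0 < N) (hα : 0 < α) (hα1 : α < 1) (hε : 0 < ε) (hε1 : ε < 1)
    (hlam : (lam : ℝ) = Real.exp (-ε)) (h2 : 1000 ^ 2 * (d : ℝ) ≤ N ^ 2 * α ^ 4)
    (h3 : 1000 ^ 3 * (d : ℝ) ^ 2 ≤ N ^ 3 * α ^ 4 * ε ^ 2)
    (h4 : 1000 ^ 4 * (d : ℝ) ^ 3 ≤ N ^ 4 * α ^ 4 * ε ^ 4) (D : PMF (Fin d))
    (hSM : sqDev N D ≤ M) (hM : α ^ 2 * N ^ 2 / d ≤ M) :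
    (indep fun j => noisyCount (N * (D j).toNNReal) lam).toMeasure
      {c | M / 2 ≤ |∑ j, chiTerm (N / d) (c j) - (sqDev N D + d * noiseVar lam)|} ≤
        ENNReal.ofReal (1 / 10) := by
  have hd : (1 : ℝ) ≤ d := by exact_mod_cast NeZero.one_le
  have hN' : (0 : ℝ) < N := hN
  have hM0 : 0 < M := lt_of_lt_of_le (by positivity) hM
  set r : Fin d → ℝ≥0 := fun j => N * (D j).toNNReal with hr
  have hrj : ∀ j, (r j : ℝ) = N * (D j).toReal := fun j => by
    rw [hr, NNReal.coe_mul]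
    rfl
  have hm := fun j => chiTerm_moments (lam := lam) (r j) (N / d)
  obtain ⟨hL, hE⟩ := pi_memLp_sum fun j => (hm j).1
  have hE' : ∑ j, ∫ k, chiTerm (N / d) k ∂(noisyCount (r j) lam).toMeasure =
      sqDev N D + d * noiseVar lam := by
    rw [Finset.sum_congr rfl fun j _ => (hm j).2.1, Finset.sum_add_distrib, sqDev]
    simp [hrj]
  have hV : Var[∑ j, fun c : Fin d → ℤ => chiTerm (N / d) (c j);
      Measure.pi fun j => (noisyCount (r j) lam).toMeasure] ≤ M ^ 2 / 40 := by
    rw [variance_sum_pi fun j => (hm j).1]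
    refine (Finset.sum_le_sum fun j _ => (hm j).2.2).trans ?_
    refine (sum_variance_bound (N / d) (noiseVar lam) (240 / (1 - (lam : ℝ)) ^ 4)
      fun j => (r j : ℝ)).trans ?_
    simp only [hrj]
    have hl := half_le_one_sub_exp_neg hε hε1
    rw [← hlam] at hl
    refine variance_le_sq_div hd hN' hα hα1 hε hε1 h2 h3 h4 ?_ ?_
      (Finset.sum_nonneg fun _ _ => sq_nonneg _) hSM hM
    · refine noiseVar_le.trans ?_
      calc 12 / (1 - (lam : ℝ)) ^ 2 ≤ 12 / (ε / 2) ^ 2 := by gcongr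
        _ = _ := by ring
    · calc 240 / (1 - (lam : ℝ)) ^ 4 ≤ 240 / (ε / 2) ^ 4 := by gcongr
        _ = _ := by ring
  have hcheb := meas_ge_le_variance_div_sq hL (half_pos hM0)
  rw [hE, hE'] at hcheb
  rw [toMeasure_indep]
  refine le_trans (le_of_eq ?_) (hcheb.trans (ENNReal.ofReal_le_ofReal ?_))
  · simp only [Finset.sum_apply]
    rfl
  · rw [div_le_iff₀ (by positivity)]
    linarith

end Concentration

/-! ### The output of the protocol -/

section Output

variable {d m n τ : ℕ} {lam : Set.Ioo (0 : ℝ) 1} {N ℓ : ℝ}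

open Classical in
/-- The verdict on a histogram. -/
def verdictOf (d : ℕ) (N ℓ : ℝ) (c : Fin d → ℝ) : Verdict :=
  if chiSq d N c ≤ ℓ then Verdict.uniform else Verdict.notUniform

theorem utAnalyzer_of_pos (hn : 0 < n) (y : Msg d m) : utAnalyzer d n m τ lam N ℓ y =
    PMF.pure (verdictOf d N ℓ fun j => sumAnalyzer n m 1 τ (y j)) := by
  rw [utAnalyzer, noisyCounts, if_pos hn, PMF.pure_map]
  rfl

variable {O : Type*} [MeasurableSpace O] {I : List (Msg d m) → ProbabilityMeasure O}
  {post : Kernel O (Msg d m)} [IsMarkovKernel post]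

instance {X Y O Z : Type*} [MeasurableSpace O] [MeasurableSpace Z] (P : Protocol n X Y O Z)
    (x : Fin n → X) : IsProbabilityMeasure (P.output x) := by
  have := P.markov
  rw [Protocol.output]
  infer_instance

theorem lintegral_mix {A B : Type*} [MeasurableSpace B] (p : PMF A) (κ : A → ProbabilityMeasure B)
    (f : B → ℝ≥0∞) : ∫⁻ b, f b ∂mix p κ = ∑' a, p a * ∫⁻ b, f b ∂(κ a : Measure B) := by
  simp only [mix, lintegral_sum_measure, lintegral_smul_measure, smul_eq_mul]

theorem output_apply {X Y O Z : Type*} [MeasurableSpace O] [MeasurableSpace Z]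
    (P : Protocol n X Y O Z) (x : Fin n → X) {s : Set Z} (hs : MeasurableSet s) :
    P.output x s = ∑' y, P.messages x y *
      ∫⁻ o, P.analyzer o s ∂(P.intermediary y : Measure O) := by
  rw [Protocol.output, Measure.bind_apply hs P.analyzer.aemeasurable, lintegral_mix]

theorem utProtocol_output_apply (x : Fin n → Fin d) (v : Verdict) :
    (utProtocol d n m τ lam N ℓ I post).output x {v} =
      ∑' y, (utProtocol d n m τ lam N ℓ I post).messages x y *
        ∫⁻ y', (utAnalyzer d n m τ lam N ℓ y').toMeasure {v} ∂(I y : Measure O).bind post := by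
  rw [output_apply _ _ (MeasurableSet.of_discrete)]
  refine tsum_congr fun y => ?_
  congr 1
  rw [Measure.lintegral_bind post.aemeasurable Measurable.of_discrete.aemeasurable]
  refine lintegral_congr fun o => ?_
  exact Kernel.comp_apply' _ _ _ MeasurableSet.of_discrete

theorem abs_sub_le_statDist {Ω : Type*} [MeasurableSpace Ω] (μ ν : Measure Ω)
    [IsProbabilityMeasure μ] [IsProbabilityMeasure ν] {E : Set Ω} (hE : MeasurableSet E) :
    |μ.real E - ν.real E| ≤ statDist μ ν := by
  refine le_ciSup (f := fun E : {E : Set Ω // MeasurableSet E} => |μ.real E - ν.real E|)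
    ⟨1, ?_⟩ ⟨E, hE⟩
  rintro _ ⟨F, rfl⟩
  have h1 := measureReal_le_one (μ := μ) (s := F)
  have h2 := measureReal_le_one (μ := ν) (s := F)
  have h3 := measureReal_nonneg (μ := μ) (s := F)
  have h4 := measureReal_nonneg (μ := ν) (s := F)
  exact abs_le.2 ⟨by linarith, by linarith⟩

theorem statDist_le_one {Ω : Type*} [MeasurableSpace Ω] (μ ν : Measure Ω)
    [IsProbabilityMeasure μ] [IsProbabilityMeasure ν] : statDist μ ν ≤ 1 := by
  have : Nonempty {E : Set Ω // MeasurableSet E} := ⟨⟨∅, MeasurableSet.empty⟩⟩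
  refine ciSup_le fun F => ?_
  have h1 := measureReal_le_one (μ := μ) (s := F)
  have h2 := measureReal_le_one (μ := ν) (s := F)
  have h3 := measureReal_nonneg (μ := μ) (s := F)
  have h4 := measureReal_nonneg (μ := ν) (s := F)
  exact abs_le.2 ⟨by linarith, by linarith⟩

theorem CorrectVia.bind_apply_le {q : ℝ} (hI : CorrectVia q n (aggregator d m) I post)
    (y : List (Msg d m)) (hy : y.length ≤ n) (E : Set (Msg d m)) :
    (I y : Measure O).bind post E ≤
      Measure.dirac (aggregator d m y) E + ENNReal.ofReal q := by
  have h := (abs_sub_le_statDist ((I y : Measure O).bind post)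
    (Measure.dirac (aggregator d m y)) (MeasurableSet.of_discrete (s := E))).trans (hI y hy)
  have h' := (abs_le.1 h).2
  rw [← ENNReal.ofReal_toReal (measure_ne_top ((I y : Measure O).bind post) E),
    ← ENNReal.ofReal_toReal (measure_ne_top (Measure.dirac (aggregator d m y)) E)]
  refine (ENNReal.ofReal_le_ofReal ?_).trans ENNReal.ofReal_add_le
  simp only [Measure.real] at h'
  linarith

theorem prod_pure {M : Type*} [AddCommMonoid M] (a : Fin n → M) :
    ∏ i, PMF.pure (a i) = PMF.pure (∑ i, a i) := by
  rw [← indep_map_sum, indep_pure, PMF.pure_map]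

/-- The `n` shares of shape `2 / n` combine to shape 2. For `n = 0` the sum is empty and carries no
noise, hence the hypothesis `0 < n`. -/
theorem messages_map_aggregator {O Z : Type*} [MeasurableSpace O] [MeasurableSpace Z]
    (P : Protocol n (Fin d) (Msg d m) O Z) (hP : ∀ i, P.randomizer i = utRandomizer d n m lam)
    (hn : 0 < n) (x : Fin n → Fin d) : (P.messages x).map (aggregator d m) =
      mapHom (castVec d m) (PMF.pure (hist x) * noise d 2 lam) := by
  have h : (aggregator d m ∘ List.ofFn : (Fin n → Msg d m) → Msg d m) = fun y => ∑ i, y i := by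
    funext y
    exact List.sum_ofFn
  have hn' : (n : ℝ≥0) ≠ 0 := by exact_mod_cast hn.ne'
  rw [Protocol.messages, PMF.map_comp, h, indep_map_sum]
  simp only [hP, utRandomizer_eq]
  rw [Finset.prod_mul_distrib, Finset.prod_const, Finset.card_univ, Fintype.card_fin, ← map_pow,
    noise_pow, mul_div_cancel₀ _ hn', ← map_prod, prod_pure, ← map_mul]
  rfl

theorem messages_length {X Y O Z : Type*} [MeasurableSpace O] [MeasurableSpace Z]
    (P : Protocol n X Y O Z) (x : Fin n → X) (y : List Y) (hy : P.messages x y ≠ 0) :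
    y.length ≤ n := by
  obtain ⟨z, -, rfl⟩ := (PMF.mem_support_map_iff _ _ _).1 ((PMF.mem_support_iff _ _).2 hy)
  exact List.length_ofFn.le

/-- The probability that the noise is too large in some coordinate for the analyzer to decode. -/
def overflowProb (d τ : ℕ) (lam : Set.Ioo (0 : ℝ) 1) : ℝ≥0∞ :=
  (noise d 2 lam).toMeasure {η | ∃ j, 2 * τ < (η j).natAbs}

/-- The window `[-2τ, n + 2τ]` has `n + 4τ + 1 ≤ m` integers, so residues determine them; a negative
`c` is represented by `c + m`, which exceeds `n + 2τ`. -/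
theorem sumAnalyzer_intCast {c : ℤ} (h1 : -(2 * τ : ℤ) ≤ c) (h2 : c ≤ n + 2 * τ)
    (hm : n + 4 * τ < m) : sumAnalyzer n m 1 τ (c : ZMod m) = c := by
  have : NeZero m := ⟨by omega⟩
  have hval : (((c : ZMod m).val : ℕ) : ℤ) = c % m := ZMod.val_intCast c
  rw [sumAnalyzer]
  rcases le_or_gt 0 c with h | h
  · rw [Int.emod_eq_of_lt h (by omega)] at hval
    rw [if_neg (by omega)]
    simp only [Nat.cast_one, div_one]
    exact_mod_cast hval
  · have h3 : c % m = c + m := by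
      rw [← Int.add_emod_right, Int.emod_eq_of_lt (by omega) (by omega)]
    rw [h3] at hval
    rw [if_pos (by omega)]
    have : (((c : ZMod m).val : ℕ) : ℝ) = c + m := by exact_mod_cast hval
    simp only [this, Nat.cast_one, div_one]
    ring

theorem hist_apply_mem (x : Fin n → Fin d) (j : Fin d) : 0 ≤ hist x j ∧ hist x j ≤ n := by
  have h : hist x j = ∑ i, oneHot (x i) j := by rw [hist, Finset.sum_apply]
  rw [h]
  constructor
  · exact Finset.sum_nonneg fun i _ => by rw [oneHot]; split_ifs <;> norm_num
  · refine (Finset.sum_le_card_nsmul _ _ 1 fun i _ => ?_).trans (by simp)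
    rw [oneHot]
    split_ifs <;> norm_num

/-- For `n > 0` the analyzer is deterministic, so a verdict is an event on the claimed sums.
Replacing these by the true sums costs `q`, and decoding the true sums fails only if some noise
coordinate exceeds `2τ` in absolute value. -/
theorem utProtocol_output_le {q : ℝ} (hn : 0 < n) (hm : n + 4 * τ < m)
    (hI : CorrectVia q n (aggregator d m) I post) (x : Fin n → Fin d) (v : Verdict) :
    (utProtocol d n m τ lam N ℓ I post).output x {v} ≤
      (PMF.pure (hist x) * noise d 2 lam).toMeasure
        {c | verdictOf d N ℓ (fun j => (c j : ℝ)) = v} + (overflowProb d τ lam + ENNReal.ofReal q) := by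
  set P := utProtocol d n m τ lam N ℓ I post
  set E : Set (Msg d m) := {y | verdictOf d N ℓ (fun j => sumAnalyzer n m 1 τ (y j)) = v}
  have hind : ∀ y' : Msg d m, (utAnalyzer d n m τ lam N ℓ y').toMeasure {v} = E.indicator 1 y' := by
    intro y'
    rw [utAnalyzer_of_pos hn, PMF.toMeasure_pure, Measure.dirac_apply' _ MeasurableSet.of_discrete]
    rfl
  have hagg : ∑' y, P.messages x y * Measure.dirac (aggregator d m y) E =
      (noise d 2 lam).toMeasure {η | castVec d m (hist x + η) ∈ E} := by
    have h1 := tsum_map_mul (P.messages x) (aggregator d m) fun s => Measure.dirac s E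
    have h2 := PMF.toMeasure_map_apply (castVec d m ∘ (hist x + ·)) (noise d 2 lam) E
      Measurable.of_discrete MeasurableSet.of_discrete
    change _ = (noise d 2 lam).toMeasure ((castVec d m ∘ (hist x + ·)) ⁻¹' E)
    rw [← h1, messages_map_aggregator (lam := lam) P (fun _ => rfl) hn, pure_mul_eq_map, mapHom_apply,
      PMF.map_comp, ← h2, PMF.toMeasure_apply_eq_tsum]
    refine tsum_congr fun s => ?_
    rw [Measure.dirac_apply' _ MeasurableSet.of_discrete]
    by_cases hs : s ∈ E <;> simp [hs]
  calc P.output x {v} ≤ ∑' y, P.messages x y *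
        (Measure.dirac (aggregator d m y) E + ENNReal.ofReal q) := by
        rw [utProtocol_output_apply]
        refine ENNReal.tsum_le_tsum fun y => ?_
        by_cases hy : P.messages x y = 0
        · rw [hy, zero_mul, zero_mul]
        · refine mul_le_mul_right ?_ _
          simp only [hind]
          rw [lintegral_indicator_one MeasurableSet.of_discrete]
          exact hI.bind_apply_le y (messages_length P x y hy) E
    _ = (noise d 2 lam).toMeasure {η | castVec d m (hist x + η) ∈ E} + ENNReal.ofReal q := by
        simp only [mul_add, ENNReal.tsum_add, ENNReal.tsum_mul_right, PMF.tsum_coe, one_mul, hagg]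
    _ ≤ (noise d 2 lam).toMeasure
          ({η | verdictOf d N ℓ (fun j => ((hist x + η) j : ℝ)) = v} ∪
            {η | ∃ j, 2 * τ < (η j).natAbs}) + ENNReal.ofReal q := by
        refine add_le_add_left (measure_mono fun η hη => ?_) _
        by_cases hbad : ∃ j, 2 * τ < (η j).natAbs
        · exact Or.inr hbad
        · left
          push Not at hbad
          have : (fun j => sumAnalyzer n m 1 τ (castVec d m (hist x + η) j)) =
              fun j => ((hist x + η) j : ℝ) := by
            funext j
            have h1 := hbad j
            have h2 := hist_apply_mem x j
            rw [castVec_apply]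
            exact sumAnalyzer_intCast (by rw [Pi.add_apply]; omega) (by rw [Pi.add_apply]; omega) hm
          have hη' : verdictOf d N ℓ (fun j => sumAnalyzer n m 1 τ
            (castVec d m (hist x + η) j)) = v := hη
          rwa [this] at hη'
    _ ≤ _ := by
        rw [← add_assoc]
        refine add_le_add_left ((measure_union_le _ _).trans_eq ?_) _
        rw [pure_mul_eq_map, PMF.toMeasure_map_apply _ _ _ Measurable.of_discrete
          MeasurableSet.of_discrete]
        rfl

/-- Continuity from above suffices: `τ` may depend on `d` and `λ`, and the sample complexity does
not involve it. -/
theorem exists_overflowProb_le (d : ℕ) (lam : Set.Ioo (0 : ℝ) 1) {δ : ℝ≥0∞} (hδ : 0 < δ) :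
    ∃ τ, overflowProb d τ lam ≤ δ := by
  have hanti : Antitone fun τ : ℕ => {η : Fin d → ℤ | ∃ j, 2 * τ < (η j).natAbs} := by
    intro a b hab η ⟨j, hj⟩
    exact ⟨j, by omega⟩
  have h := tendsto_measure_iInter_atTop (μ := (noise d 2 lam).toMeasure)
    (fun τ => (MeasurableSet.of_discrete (s := {η : Fin d → ℤ |
      ∃ j, 2 * τ < (η j).natAbs})).nullMeasurableSet) hanti ⟨0, measure_ne_top _ _⟩
  have hempty : ⋂ τ : ℕ, {η : Fin d → ℤ | ∃ j, 2 * τ < (η j).natAbs} = ∅ := by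
    refine Set.eq_empty_of_forall_notMem fun η hη => ?_
    -- A noise vector does not overflow once `τ` is the sum of its absolute values.
    obtain ⟨j, hj⟩ := Set.mem_iInter.1 hη (∑ j, (η j).natAbs)
    have : (η j).natAbs ≤ ∑ j, (η j).natAbs :=
      Finset.single_le_sum (f := fun j => (η j).natAbs) (fun _ _ => Nat.zero_le _)
        (Finset.mem_univ j)
    omega
  rw [hempty, measure_empty] at h
  obtain ⟨τ, hτ⟩ := (h.eventually (ge_mem_nhds hδ)).exists
  exact ⟨τ, hτ⟩

end Output

/-! ### A Poisson number of users -/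

section PoissonUsers

/-- The probability that the protocol reports `v`. -/
def probVerdict {d : ℕ} {Y O : ℕ → Type*} [∀ n, MeasurableSpace (O n)]
    (P : (n : ℕ) → Protocol n (Fin d) (Y n) (O n) Verdict) (N : ℝ≥0) (D : PMF (Fin d))
    (v : Verdict) : ℝ≥0∞ :=
  ∫⁻ n, ∑' x : Fin n → Fin d, indep (fun _ => D) x * (P n).output x {v} ∂(poissonMeasure N)

variable {d : ℕ}

theorem probVerdict_add {Y O : ℕ → Type*} [∀ n, MeasurableSpace (O n)]
    (P : (n : ℕ) → Protocol n (Fin d) (Y n) (O n) Verdict) (N : ℝ≥0) (D : PMF (Fin d)) :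
    probVerdict P N D Verdict.notUniform + probVerdict P N D Verdict.uniform = 1 := by
  rw [probVerdict, probVerdict, ← lintegral_add_left Measurable.of_discrete]
  have h : ∀ n, ∀ x : Fin n → Fin d, (P n).output x {Verdict.notUniform} +
      (P n).output x {Verdict.uniform} = 1 := by
    intro n x
    rw [← measure_union (by simp) MeasurableSet.of_discrete]
    have : ({Verdict.notUniform} ∪ {Verdict.uniform} : Set Verdict) = Set.univ := by
      ext v
      cases v <;> simp
    rw [this, measure_univ]
  simp only [← ENNReal.tsum_add, ← mul_add, h, mul_one, PMF.tsum_coe]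
  simp

theorem tsum_poissonLaw_mul_hist (N : ℝ≥0) (D : PMF (Fin d)) (lam : Set.Ioo (0 : ℝ) 1)
    (V : Set (Fin d → ℤ)) :
    ∑' n, poissonLaw N n * ∑' x : Fin n → Fin d, indep (fun _ => D) x *
      (PMF.pure (hist x) * noise d 2 lam).toMeasure V =
        (indep fun j => noisyCount (N * (D j).toNNReal) lam).toMeasure V := by
  have h : (indep fun j => noisyCount (N * (D j).toNNReal) lam) =
      (poissonLaw N).bind fun n => (indep fun _ : Fin n => D).bind fun x =>
        PMF.pure (hist x) * noise d 2 lam := by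
    simp only [noisyCount]
    rw [indep_mul, ← poissonLaw_bind_hist, pmf_mul_def, PMF.bind_bind]
    simp only [PMF.bind_map, pure_mul_eq_map]
    rfl
  rw [h, PMF.toMeasure_bind_apply _ _ _ MeasurableSet.of_discrete]
  refine tsum_congr fun n => ?_
  rw [PMF.toMeasure_bind_apply _ _ _ MeasurableSet.of_discrete]

/-- The event `n = 0` is given up at cost `exp (-N)`, so the analyzer's own noise in that case never
has to be analyzed. -/
theorem probVerdict_le {m : ℕ → ℕ} {τ : ℕ} {lam : Set.Ioo (0 : ℝ) 1} {O : ℕ → Type*}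
    [∀ n, MeasurableSpace (O n)] {I : (n : ℕ) → List (Msg d (m n)) → ProbabilityMeasure (O n)}
    {post : (n : ℕ) → Kernel (O n) (Msg d (m n))} [∀ n, IsMarkovKernel (post n)] {q : ℝ}
    (hm : ∀ n, n + 4 * τ < m n) (hI : ∀ n, CorrectVia q n (aggregator d (m n)) (I n) (post n))
    (N : ℝ≥0) (ℓ : ℝ) (D : PMF (Fin d)) (v : Verdict) :
    probVerdict (fun n => utProtocol d n (m n) τ lam N ℓ (I n) (post n)) N D v ≤
      ENNReal.ofReal (Real.exp (-N)) + (overflowProb d τ lam + ENNReal.ofReal q) +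
        (indep fun j => noisyCount (N * (D j).toNNReal) lam).toMeasure
          {c | verdictOf d N ℓ (fun j => (c j : ℝ)) = v} := by
  set V := {c : Fin d → ℤ | verdictOf d N ℓ (fun j => (c j : ℝ)) = v}
  set δ := overflowProb d τ lam + ENNReal.ofReal q
  have hpois : poissonMeasure N = (poissonLaw N).toMeasure := (Measure.toPMF_toMeasure _).symm
  have h0 : poissonLaw N 0 = ENNReal.ofReal (Real.exp (-N)) := by
    rw [poissonLaw, Measure.toPMF_apply, poissonMeasure_singleton]
    simp
  rw [probVerdict, hpois, lintegral_toMeasure]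
  calc _ ≤ ∑' n, (poissonLaw N n * (if n = 0 then 1 else 0) + poissonLaw N n * δ +
        poissonLaw N n * ∑' x : Fin n → Fin d, indep (fun _ => D) x *
          (PMF.pure (hist x) * noise d 2 lam).toMeasure V) := by
        refine ENNReal.tsum_le_tsum fun n => ?_
        rw [← mul_add, ← mul_add]
        refine mul_le_mul_right ?_ _
        rcases Nat.eq_zero_or_pos n with rfl | hn
        · rw [if_pos rfl, add_assoc]
          refine le_add_right ?_
          calc _ ≤ ∑' x : Fin 0 → Fin d, indep (fun _ => D) x * 1 :=
                ENNReal.tsum_le_tsum fun x => mul_le_mul_right prob_le_one _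
            _ = 1 := by rw [ENNReal.tsum_mul_right, PMF.tsum_coe, one_mul]
        · rw [if_neg hn.ne', zero_add]
          calc _ ≤ ∑' x : Fin n → Fin d, indep (fun _ => D) x *
                ((PMF.pure (hist x) * noise d 2 lam).toMeasure V + δ) :=
                ENNReal.tsum_le_tsum fun x =>
                  mul_le_mul_right (utProtocol_output_le hn (hm n) (hI n) x v) _
            _ = _ := by
                simp only [mul_add, ENNReal.tsum_add, ENNReal.tsum_mul_right, PMF.tsum_coe,
                  one_mul]
                rw [add_comm]
    _ = _ := by
        rw [ENNReal.tsum_add, ENNReal.tsum_add, tsum_poissonLaw_mul_hist, ENNReal.tsum_mul_right,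
          PMF.tsum_coe, one_mul, tsum_eq_single 0 fun n hn => by rw [if_neg hn, mul_zero],
          if_pos rfl, mul_one, h0]

end PoissonUsers

/-! ### Uniformity testing -/

section Testing

variable {d : ℕ} [NeZero d]

theorem chiSq_le_iff {N : ℝ} (hN : 0 < N) (t : ℝ) (c : Fin d → ℤ) :
    chiSq d N (fun j => (c j : ℝ)) ≤ d / N * t ↔ ∑ j, chiTerm (N / d) (c j) ≤ t := by
  have hd : (0 : ℝ) < d := by exact_mod_cast Nat.pos_of_neZero d
  exact mul_le_mul_iff_of_pos_left (div_pos hd hN)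

theorem sqDev_uniform (N : ℝ≥0) : sqDev N (PMF.uniformOfFintype (Fin d)) = 0 := by
  simp [sqDev, div_eq_mul_inv]

/-- This loses a factor 2 against the sharp bound by half the `ℓ¹` distance; the constant `K`
absorbs it. -/
theorem abs_sub_le_sum_abs (D : PMF (Fin d)) (E : Set (Fin d)) :
    |D.toMeasure.real E - (PMF.uniformOfFintype (Fin d)).toMeasure.real E| ≤
      ∑ j, |(D j).toReal - 1 / d| := by
  classical
  have h : ∀ p : PMF (Fin d), p.toMeasure.real E = ∑ j, if j ∈ E then (p j).toReal else 0 := by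
    intro p
    rw [measureReal_def, PMF.toMeasure_apply_fintype,
      ENNReal.toReal_sum fun j _ => by
        by_cases hj : j ∈ E <;> simp [hj, p.apply_ne_top]]
    refine Finset.sum_congr rfl fun j _ => ?_
    by_cases hj : j ∈ E <;> simp [hj]
  rw [h, h, ← Finset.sum_sub_distrib]
  refine (Finset.abs_sum_le_sum_abs _ _).trans (Finset.sum_le_sum fun j _ => ?_)
  split_ifs
  · simp
  · simp

theorem sqDev_ge_of_lt_statDist {α : ℝ} (hα : 0 < α) (N : ℝ≥0) (D : PMF (Fin d))
    (h : α < statDist D.toMeasure (PMF.uniformOfFintype (Fin d)).toMeasure) :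
    α ^ 2 * N ^ 2 / d ≤ sqDev N D := by
  have hd : (0 : ℝ) < d := by exact_mod_cast Nat.pos_of_neZero d
  have : Nonempty {E : Set (Fin d) // MeasurableSet E} := ⟨⟨∅, MeasurableSet.empty⟩⟩
  obtain ⟨E, hE⟩ := exists_lt_of_lt_ciSup h
  have h1 := hE.le.trans (abs_sub_le_sum_abs D E)
  have h2 := sq_sum_le_card_mul_sum_sq (s := Finset.univ)
    (f := fun j : Fin d => |(D j).toReal - 1 / d|)
  have h3 : α ^ 2 ≤ (∑ j, |(D j).toReal - 1 / d|) ^ 2 := pow_le_pow_left₀ hα.le h1 2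
  simp only [sq_abs, Finset.card_univ, Fintype.card_fin] at h2
  have h4 : sqDev N D = (N : ℝ) ^ 2 * ∑ j, ((D j).toReal - 1 / d) ^ 2 := by
    rw [sqDev, Finset.mul_sum]
    refine Finset.sum_congr rfl fun j _ => ?_
    ring
  rw [h4, div_le_iff₀ hd]
  have := mul_le_mul_of_nonneg_left (h3.trans h2) (sq_nonneg (N : ℝ))
  linarith

/-- Each summand alone is at most `N / 1000`; raising it to the power 2, 3 or 4 clears the
fractional exponents. -/
theorem sampleSize_bounds {d N α ε : ℝ} (hd : 1 ≤ d) (hα : 0 < α) (hα1 : α < 1) (hε : 0 < ε)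
    (hN : 1000 * (d ^ (3 / 4 : ℝ) / (α * ε) +
      d ^ (2 / 3 : ℝ) / (α ^ (4 / 3 : ℝ) * ε ^ (2 / 3 : ℝ)) + d ^ (1 / 2 : ℝ) / α ^ 2) ≤ N) :
    1000 ≤ N ∧ 1000 ^ 2 * d ≤ N ^ 2 * α ^ 4 ∧ 1000 ^ 3 * d ^ 2 ≤ N ^ 3 * α ^ 4 * ε ^ 2 ∧
      1000 ^ 4 * d ^ 3 ≤ N ^ 4 * α ^ 4 * ε ^ 4 := by
  have hd0 : 0 < d := by linarith
  have p1 : 0 < d ^ (3 / 4 : ℝ) / (α * ε) := by positivity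
  have p2 : 0 < d ^ (2 / 3 : ℝ) / (α ^ (4 / 3 : ℝ) * ε ^ (2 / 3 : ℝ)) := by positivity
  have p3 : 0 < d ^ (1 / 2 : ℝ) / α ^ 2 := by positivity
  have hpow : ∀ {x : ℝ} (a : ℝ) (k : ℕ), 0 < x → (x ^ a) ^ k = x ^ (a * k) := fun a k hx => by
    rw [← Real.rpow_natCast, ← Real.rpow_mul hx.le]
  have q2 : 1000 * (d ^ (1 / 2 : ℝ) / α ^ 2) ≤ N := by linarith
  have q3 : 1000 * (d ^ (2 / 3 : ℝ) / (α ^ (4 / 3 : ℝ) * ε ^ (2 / 3 : ℝ))) ≤ N := by linarith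
  have q4 : 1000 * (d ^ (3 / 4 : ℝ) / (α * ε)) ≤ N := by linarith
  have r2 := pow_le_pow_left₀ (by positivity) q2 2
  have r3 := pow_le_pow_left₀ (by positivity) q3 3
  have r4 := pow_le_pow_left₀ (by positivity) q4 4
  have s2 : (d ^ (1 / 2 : ℝ)) ^ 2 = d := by rw [hpow _ _ hd0]; norm_num
  have s3 : (d ^ (2 / 3 : ℝ)) ^ 3 = d ^ 2 := by
    rw [hpow _ _ hd0, ← Real.rpow_natCast d 2]; norm_num
  have s4 : (d ^ (3 / 4 : ℝ)) ^ 4 = d ^ 3 := by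
    rw [hpow _ _ hd0, ← Real.rpow_natCast d 3]; norm_num
  have s5 : (α ^ (4 / 3 : ℝ)) ^ 3 = α ^ 4 := by
    rw [hpow _ _ hα, ← Real.rpow_natCast α 4]; norm_num
  have s6 : (ε ^ (2 / 3 : ℝ)) ^ 3 = ε ^ 2 := by
    rw [hpow _ _ hε, ← Real.rpow_natCast ε 2]; norm_num
  rw [mul_pow, div_pow, s2, mul_div_assoc', div_le_iff₀ (by positivity)] at r2
  rw [mul_pow, div_pow, mul_pow, s3, s5, s6, mul_div_assoc', div_le_iff₀ (by positivity)] at r3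
  rw [mul_pow, div_pow, s4, mul_div_assoc', div_le_iff₀ (by positivity)] at r4
  refine ⟨?_, ?_, ?_, ?_⟩
  · refine le_trans ?_ q2
    have h1 : (1 : ℝ) ≤ d ^ (1 / 2 : ℝ) := Real.one_le_rpow hd (by norm_num)
    have h2 : α ^ 2 ≤ 1 := pow_le_one₀ hα.le hα1.le
    have h3 : 1 ≤ d ^ (1 / 2 : ℝ) / α ^ 2 := by
      rw [le_div_iff₀ (by positivity)]
      linarith
    linarith
  · refine r2.trans_eq ?_
    ring
  · refine r3.trans_eq ?_
    ring
  · refine r4.trans_eq ?_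
    ring

theorem exp_neg_le_of_le {N : ℝ} (hN : 1000 ≤ N) : Real.exp (-N) ≤ 1 / 100 := by
  rw [Real.exp_neg, inv_eq_one_div]
  refine one_div_le_one_div_of_le (by norm_num) ?_
  linarith [Real.add_one_le_exp N]

theorem total_error_le {N : ℝ} (hN : 1000 ≤ N) {δ p : ℝ≥0∞} (hδ : δ ≤ ENNReal.ofReal (1 / 100))
    (hp : p ≤ ENNReal.ofReal (1 / 10)) :
    ENNReal.ofReal (Real.exp (-N)) + (δ + ENNReal.ofReal (1 / 200)) + p ≤ 1 / 3 := by
  have h1 := ENNReal.ofReal_le_ofReal (exp_neg_le_of_le hN)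
  refine (add_le_add (add_le_add h1 (add_le_add hδ le_rfl)) hp).trans ?_
  rw [← ENNReal.ofReal_add (by norm_num) (by norm_num),
    ← ENNReal.ofReal_add (by norm_num) (by norm_num),
    ← ENNReal.ofReal_add (by norm_num) (by norm_num)]
  have : (1 / 3 : ℝ≥0∞) = ENNReal.ofReal (1 / 3) := by
    rw [ENNReal.ofReal_div_of_pos (by norm_num)]
    simp
  rw [this]
  -- The budget is `1/100 + 1/100 + 1/200 + 1/10 = 1/8`.
  exact ENNReal.ofReal_le_ofReal (by norm_num)

theorem dlapTrunc_zero (lam : Set.Ioo (0 : ℝ) 1) : dlapTrunc 0 lam = PMF.pure 0 := by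
  have h : ∀ v : ℤ, v ≠ 0 → dlapTrunc 0 lam v = 0 := by
    intro v hv
    rw [dlapTrunc, PMF.normalize_apply, dlapWeight, if_neg (by omega), zero_mul]
  have h0 : dlapTrunc 0 lam 0 = 1 := by
    rw [← (dlapTrunc 0 lam).tsum_coe, tsum_eq_single 0 fun v hv => h v hv]
  ext v
  rw [PMF.pure_apply]
  split_ifs with hv
  · rw [hv, h0]
  · exact h v hv

theorem noisyCounts_one_zero {d : ℕ} (n : ℕ) (lam : Set.Ioo (0 : ℝ) 1) (y : Msg d 1) :
    noisyCounts d n 1 0 lam y = PMF.pure 0 := by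
  rw [noisyCounts]
  split_ifs with hn
  · congr 1
    funext j
    have : (y j).val = 0 := by
      have := ZMod.val_lt (y j)
      omega
    simp [sumAnalyzer, this]
  · simp only [dlapTrunc_zero, PMF.pure_bind, PMF.pure_map, add_zero, Int.cast_zero]
    exact indep_pure 0

/-- If `1 ≤ α` no distribution is `α`-far from uniform, and the tester with modulus `1` never
reports "not uniform". -/
theorem solvesUniformityTesting_of_one_le {α : ℝ} (hα : 1 ≤ α) (lam : Set.Ioo (0 : ℝ) 1)
    {O : ℕ → Type*} [∀ n, MeasurableSpace (O n)]
    (I : (n : ℕ) → List (Msg d 1) → ProbabilityMeasure (O n))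
    (post : (n : ℕ) → Kernel (O n) (Msg d 1)) [∀ n, IsMarkovKernel (post n)] (Nstar : ℝ) :
    SolvesUniformityTesting (fun N n => utProtocol d n 1 0 lam (N : ℝ) (chiSq d N 0)
      (I n) (post n)) α Nstar := by
  intro N _
  constructor
  · have h : ∀ n (y : Msg d 1), (utAnalyzer d n 1 0 lam N (chiSq d N 0) y).toMeasure
        {Verdict.notUniform} = 0 := by
      intro n y
      rw [utAnalyzer, noisyCounts_one_zero, PMF.pure_map, if_pos le_rfl, PMF.toMeasure_pure,
        Measure.dirac_apply' _ MeasurableSet.of_discrete]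
      simp
    simp [probNotUniform, utProtocol_output_apply, h]
  · intro D hD
    exact absurd (hD.trans_le (statDist_le_one _ _)) (not_lt.2 hα)

/-- The tester of the sample complexity bound in the nondegenerate regime. -/
theorem solvesUniformityTesting_of_lt_one {ε α : ℝ} (hε : 0 < ε) (hε1 : ε < 1) (hα : 0 < α)
    (hα1 : α < 1) {lam : Set.Ioo (0 : ℝ) 1} (hlam : (lam : ℝ) = Real.exp (-ε)) {τ : ℕ}
    (hτ : overflowProb d τ lam ≤ ENNReal.ofReal (1 / 100)) {m : ℕ → ℕ}
    (hm : ∀ n, n + 4 * τ < m n) {O : ℕ → Type*} [∀ n, MeasurableSpace (O n)]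
    {I : (n : ℕ) → List (Msg d (m n)) → ProbabilityMeasure (O n)}
    {post : (n : ℕ) → Kernel (O n) (Msg d (m n))} [∀ n, IsMarkovKernel (post n)]
    (hI : ∀ n, CorrectVia (1 / 200) n (aggregator d (m n)) (I n) (post n)) :
    SolvesUniformityTesting (fun N n => utProtocol d n (m n) τ lam (N : ℝ)
      (d / N * (d * noiseVar lam + α ^ 2 * N ^ 2 / d / 2)) (I n) (post n)) α
      (1000 * ((d : ℝ) ^ (3 / 4 : ℝ) / (α * ε) +
        (d : ℝ) ^ (2 / 3 : ℝ) / (α ^ (4 / 3 : ℝ) * ε ^ (2 / 3 : ℝ)) +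
        (d : ℝ) ^ (1 / 2 : ℝ) / α ^ 2)) := by
  intro N hN
  have hd : (1 : ℝ) ≤ d := by exact_mod_cast NeZero.one_le
  obtain ⟨h1, h2, h3, h4⟩ := sampleSize_bounds hd hα hα1 hε hN
  have hN0 : (0 : ℝ) < N := by linarith
  have hconc := fun M D => noisyCounts_concentration (M := M) (lam := lam) hN0 hα hα1 hε hε1 hlam
    h2 h3 h4 D
  have hs0 : 0 ≤ α ^ 2 * (N : ℝ) ^ 2 / d := by positivity
  set s := α ^ 2 * (N : ℝ) ^ 2 / d with hs
  -- Before the scaling by `d / N`, the mean is `d * noiseVar lam` for the uniform distribution and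
  -- at least `s` more for a far one; the threshold is halfway.
  set ℓ := d / N * (d * noiseVar lam + s / 2) with hℓ
  have herr := probVerdict_le (lam := lam) hm hI N ℓ
  have hu : ∀ c : Fin d → ℤ, verdictOf d N ℓ (fun j => (c j : ℝ)) = Verdict.uniform ↔
      ∑ j, chiTerm (N / d) (c j) ≤ d * noiseVar lam + s / 2 := by
    intro c
    rw [← chiSq_le_iff hN0, ← hℓ, verdictOf]
    split_ifs with h <;> simp [h]
  have hnu : ∀ c : Fin d → ℤ, verdictOf d N ℓ (fun j => (c j : ℝ)) = Verdict.notUniform ↔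
      d * noiseVar lam + s / 2 < ∑ j, chiTerm (N / d) (c j) := by
    intro c
    rw [← not_le, ← chiSq_le_iff hN0, ← hℓ, verdictOf]
    split_ifs with h <;> simp [h]
  constructor
  · refine (herr _ Verdict.notUniform).trans (total_error_le h1 hτ ?_)
    refine (measure_mono fun c hc => ?_).trans
      (hconc s (PMF.uniformOfFintype (Fin d)) ((sqDev_uniform N).trans_le hs0) le_rfl)
    have hc' := (hnu c).1 hc
    change s / 2 ≤ |_|
    rw [sqDev_uniform]
    exact le_trans (by linarith) (le_abs_self _)
  · intro D hD
    have hS : s ≤ sqDev N D := sqDev_ge_of_lt_statDist hα N D hD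
    -- The power bound is obtained by bounding the complementary verdict, with scale `M = sqDev N
    -- D`.
    have hbad := (herr D Verdict.uniform).trans
      (total_error_le h1 hτ ((measure_mono fun c hc => ?_).trans
        (hconc (sqDev N D) D le_rfl hS)))
    · set P := fun n => utProtocol d n (m n) τ lam (N : ℝ) ℓ (I n) (post n)
      have hsum := probVerdict_add P N D
      change 2 / 3 ≤ probVerdict P N D Verdict.notUniform
      by_contra! hlt
      have h23 : (2 / 3 : ℝ≥0∞) + 1 / 3 = 1 := by
        rw [ENNReal.div_add_div_same, show (2 + 1 : ℝ≥0∞) = 3 by norm_num]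
        exact ENNReal.div_self (by norm_num) (by norm_num)
      have := ENNReal.add_lt_add_of_lt_of_le (hbad.trans_lt (by simp)).ne hlt hbad
      rw [hsum, h23] at this
      exact lt_irrefl _ this
    · have hc' := (hu c).1 hc
      -- Acceptance puts the statistic at least `sqDev N D - s / 2 ≥ sqDev N D / 2` below its mean.
      change sqDev N D / 2 ≤ |_|
      rw [abs_sub_comm]
      exact le_trans (by linarith) (le_abs_self _)

end Testing

end SecureIntermediary

end

/-! ### Choice of the parameters. -/

theorem theorem5p2 :
    -- privacy, for every choice of the remaining parameters
    (∀ (d n m τ : ℕ) (N ℓ : ℝ) (ε εhat : ℝ) (lam : Set.Ioo (0 : ℝ) 1)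
      (O : Type u) [MeasurableSpace O]
      (I : List (Msg d m) → ProbabilityMeasure O)
      (post : Kernel O (Msg d m)) [IsMarkovKernel post],
      0 < d → 0 < m → 0 < ε → ε < 1 → 0 ≤ εhat → (lam : ℝ) = Real.exp (-ε) →
      IsRelaxation εhat (1 / 200) n (aggregator d m) I post →
      (utProtocol d n m τ lam N ℓ I post).RobustlyDP (4 * εhat + 2 * ε)) ∧
    -- sample complexity: `K` is an absolute constant
    (∃ K : ℝ, 0 < K ∧
      ∀ (d : ℕ) [NeZero d] (ε α : ℝ), 0 < ε → ε < 1 → 0 < α →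
        ∃ (ℓ : ℝ≥0 → ℝ) (m : ℕ → ℕ) (τ : ℕ), (∀ n, 0 < m n) ∧
          ∀ (εhat : ℝ) (lam : Set.Ioo (0 : ℝ) 1) (O : ℕ → Type u) [∀ n, MeasurableSpace (O n)]
            (I : (n : ℕ) → List (Msg d (m n)) → ProbabilityMeasure (O n))
            (post : (n : ℕ) → Kernel (O n) (Msg d (m n))) [∀ n, IsMarkovKernel (post n)],
            0 ≤ εhat → (lam : ℝ) = Real.exp (-ε) →
            (∀ n, IsRelaxation εhat (1 / 200) n (aggregator d (m n)) (I n) (post n)) →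
            SolvesUniformityTesting
              (fun N n => utProtocol d n (m n) τ lam (N : ℝ) (ℓ N) (I n) (post n)) α
              (K * ((d : ℝ) ^ (3 / 4 : ℝ) / (α * ε) +
                (d : ℝ) ^ (2 / 3 : ℝ) / (α ^ (4 / 3 : ℝ) * ε ^ (2 / 3 : ℝ)) +
                (d : ℝ) ^ (1 / 2 : ℝ) / α ^ 2))) := by
  refine ⟨fun d n m τ N ℓ ε εhat lam O _ I post _ _ _ hε _ hεhat hlam hI =>
    utProtocol_robustlyDP d n m τ N ℓ ε εhat lam I post hε.le hεhat hlam hI.1,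
    1000, by norm_num, fun d _ ε α hε hε1 hα => ?_⟩
  -- For large `α` the bound on `N` can be too small for concentration, but then no distribution is
  -- `α`-far and a tester that always accepts suffices.
  rcases le_or_gt 1 α with hα1 | hα1
  · exact ⟨fun N => chiSq d N 0, fun _ => 1, 0, fun _ => one_pos,
      fun _ lam O _ I post _ _ _ _ => solvesUniformityTesting_of_one_le hα1 lam I post _⟩
  · let lam₀ : Set.Ioo (0 : ℝ) 1 := ⟨Real.exp (-ε), Real.exp_pos _, by
      rw [Real.exp_lt_one_iff]
      linarith⟩
    obtain ⟨τ, hτ⟩ := exists_overflowProb_le d lam₀ (δ := ENNReal.ofReal (1 / 100))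
      (ENNReal.ofReal_pos.2 (by norm_num))
    -- The modulus `n + 4 * τ + 1` is the least that decodes the whole window. The parameters are
    -- fixed through `lam₀` before `lam` is given; `hlam` identifies the two.
    refine ⟨fun N => d / N * (d * noiseVar lam₀ + α ^ 2 * N ^ 2 / d / 2),
      fun n => n + 4 * τ + 1, τ, fun n => Nat.succ_pos _, fun _ lam O _ I post _ _ hlam hI => ?_⟩
    obtain rfl : lam = lam₀ := Subtype.ext hlam
    exact solvesUniformityTesting_of_lt_one hε hε1 hα hα1 hlam hτ (fun n => Nat.lt_succ_self _)
      fun n => (hI n).2
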